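/- Let $\mathcal R=(X^*,X_*,R,R^\vee,\Pi)$ be a reduced based root datum with Weyl group $W$, affine Weyl group $W_{\mathrm{aff}}$ (generated by the reflections across the hyperplanes $\langle\alpha,\cdot\rangle=k$, $\alpha\in R$, $k\in\mathbb Z$), extended affine Weyl group $\widetilde W=X_*\rtimes W$ and apartment $\mathcal A=X_*\otimes\mathbb R$. Let $\Theta$ be an automorphism of $\mathcal R$, i.e. an automorphism of $X_*$ that stabilizes $R^\vee$ and whose dual automorphism $\Theta^*$ of $X^*$ stabilizes $R$ and $\Pi$. Let $\mathcal R^{[\Theta]}$ be the attached Steinberg fixed-point root datum: its cocharacter group is $X_*^{[\Theta]}=\{x\in X_*\mid \langle\alpha,\Theta(x)-x\rangle=0 \text{ for all }\alpha\in R\}$, its character group is the dual of $X_*^{[\Theta]}$, its roots are the restrictions $\bar\alpha$ to $X_*^{[\Theta]}$ of the $\alpha\in R$ such that $2\bar\alpha$ is not the restriction of a root, and the coroot of such an $\bar\alpha$ is the sum of the $\beta^\vee$ over the $\beta\in R$ that restrict to $\bar\alpha$ (these $\beta$ form one $\Theta^*$-orbit). Objects attached to $\mathcal R^{[\Theta]}$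 carry a superscript $[\Theta]$; in particular $\mathcal A^{[\Theta]}=X_*^{[\Theta]}\otimes\mathbb R\subset\mathcal A$, and for a facet $\mathbf f$ of $\mathcal A$ we put $\mathbf f^{[\Theta]}=\mathbf f\cap\mathcal A^{[\Theta]}$. Write $W_{\mathbf f}$ (resp. $W_{\mathbf f^{[\Theta]}}$) for the stabilizer of $\mathbf f$ in $W_{\mathrm{aff}}$ (resp. of $\mathbf f^{[\Theta]}$ in $W_{\mathrm{aff}}^{[\Theta]}$). Given an alcove $\mathbf a$, let $\Pi_{\mathbf a}$ be the set of reflections across the walls of $\mathbf a$ and $\Omega_{\mathbf a}$ the stabilizer of $\mathbf a$ in $\widetilde W$, so that $\widetilde W=W_{\mathrm{aff}}\rtimes\Omega_{\mathbf a}$. The length function and the Bruhat order of the Coxeter system $(W_{\mathrm{aff}},\Pi_{\mathbf a})$ extend to $\widetilde W$ by $\ell(w\tau)=\ell(w)$, and $w\tau\le w'\tau'$ iff $\tau=\tau'$ and $w\le w'$ ($w,w'\in W_{\mathrm{aff}}$, $\tau,\tau'\in\Omega_{\mathbf a}$). For subfacets $\mathbf f_1,\mathbf f_2$ of $\mathbf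 a$, the Bruhat order on $W_{\mathbf f_1}\backslash\widetilde W/W_{\mathbf f_2}$ compares the unique elements of minimal length of the double cosets. Theorem. Let $\mathbf a$ be an alcove of $\mathcal A$ and let $\mathbf f_1,\mathbf f_2$ be subfacets of $\mathbf a$ (i.e. facets contained in the closure of $\mathbf a$), and suppose that $\mathbf a$, $\mathbf f_1$ and $\mathbf f_2$ all meet $\mathcal A^{[\Theta]}$. Then $\mathbf a^{[\Theta]}$ is an alcove of $\mathcal A^{[\Theta]}$ with subfacets $\mathbf f_1^{[\Theta]}$, $\mathbf f_2^{[\Theta]}$. There is a unique homomorphism $j\colon\widetilde W^{[\Theta]}\to\widetilde W$ such that, for every $u\in\widetilde W^{[\Theta]}$, the affine transformation $j(u)$ of $\mathcal A$ restricts to $u$ on $\mathcal A^{[\Theta]}$, and it is injective. It induces a well-defined injective map $$W_{\mathbf f_1^{[\Theta]}}\backslash\widetilde W^{[\Theta]}/W_{\mathbf f_2^{[\Theta]}}\hookrightarrow W_{\mathbf f_1}\backslash\widetilde W/W_{\mathbf f_2}.$$ Regard the source as a subset of the target via this map, let $\le$ be the Bruhat order on the target determined by $\mathbf a$, and $\le^{[\Theta]}$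 the Bruhat order on the source determined by $\mathbf a^{[\Theta]}$. Then for all $w,x$ in the source, $$w\le^{[\Theta]}x\iff w\le x .$$ -/

import Mathlib

namespace SteinbergRootDatum

open Set Module TensorProduct
open scoped Pointwise

/-! ## Length and Bruhat order attached to a generating set of involutions -/

section Coxeter

variable {G : Type*} [Group G]

/-- The word length of `g` with respect to a set `S` (meant to consist of involutions): the least
`n` such that `g` is a product of `n` elements of `S`. -/
noncomputable def wordLength (S : Set G) (g : G) : ℕ :=
  sInf {n | ∃ l : List G, l.length = n ∧ (∀ s ∈ l, s ∈ S) ∧ l.prod = g}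

/-- The reflections of `(⟨S⟩, S)`: the conjugates in `⟨S⟩` of the elements of `S`. -/
def reflections (S : Set G) : Set G :=
  {t | ∃ g ∈ Subgroup.closure S, ∃ s ∈ S, t = g * s * g⁻¹}

/-- The Bruhat order of the Coxeter system `(⟨S⟩, S)`: the reflexive and transitive closure of the
relation `u → t u`, `t` a reflection with `ℓ(u) < ℓ(t u)`. -/
def CoxeterBruhatLE (S : Set G) : G → G → Prop :=
  Relation.ReflTransGen fun u v ↦
    ∃ t ∈ reflections S, v = t * u ∧ wordLength S u < wordLength S v

end Coxeter

/-! ## Extended affine Weyl group, apartment, facets, Bruhat order of a root datum -/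

section RootDatum

variable {ι X Y : Type*} [AddCommGroup X] [AddCommGroup Y] (P : RootDatum ι X Y)

/-- The action of the Weyl group on the cocharacters, contragredient to the one on the
characters: `⟨w x, w y⟩ = ⟨x, y⟩`. The reflection in `α` acts as `y ↦ y - ⟨α, y⟩ α^∨`. -/
noncomputable def weylAct : P.weylGroup →* (Y ≃ₗ[ℤ] Y) where
  toFun w := ((RootPairing.Equiv.coweightHom P (w : P.Aut)).unop)⁻¹
  map_one' := by simp only [OneMemClass.coe_one, map_one, MulOpposite.unop_one, inv_one]
  map_mul' v w := by simp only [Subgroup.coe_mul, map_mul, MulOpposite.unop_mul, mul_inv_rev]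

/-- The action of the Weyl group by automorphisms of the (multiplicatively written) group of
cocharacters. -/
noncomputable def weylMulAut : P.weylGroup →* MulAut (Multiplicative Y) where
  toFun w := AddEquiv.toMultiplicative (weylAct P w).toAddEquiv
  map_one' := by ext; simp
  map_mul' v w := by ext; simp

/-- The extended affine Weyl group `X_* ⋊ W`. -/
def ExtAffineWeyl : Type _ := Multiplicative Y ⋊[weylMulAut P] P.weylGroup

noncomputable instance : Group (ExtAffineWeyl P) :=
  inferInstanceAs (Group (Multiplicative Y ⋊[weylMulAut P] P.weylGroup))

/-- The element `t_y w` of the extended affine Weyl group. -/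
def ExtAffineWeyl.mk (y : Y) (w : P.weylGroup) : ExtAffineWeyl P :=
  (⟨Multiplicative.ofAdd y, w⟩ : Multiplicative Y ⋊[weylMulAut P] P.weylGroup)

/-- The translation part of an element of the extended affine Weyl group. -/
def ExtAffineWeyl.trans {P : RootDatum ι X Y} (u : ExtAffineWeyl P) : Y :=
  Multiplicative.toAdd (SemidirectProduct.left u)

/-- The linear part of an element of the extended affine Weyl group. -/
def ExtAffineWeyl.lin {P : RootDatum ι X Y} (u : ExtAffineWeyl P) : P.weylGroup :=
  SemidirectProduct.right u

/-- The apartment `X_* ⊗ ℝ` of a root datum with group of cocharacters `X_* = Y`. -/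
abbrev Apartment (Y : Type*) [AddCommGroup Y] : Type _ := ℝ ⊗[ℤ] Y

/-- The group `X_* ⋊ W` acts on the apartment by the affine transformations
`(t_y w) p = w p + y`. -/
noncomputable instance : MulAction (ExtAffineWeyl P) (Apartment Y) where
  smul u p := (weylAct P u.lin).toLinearMap.baseChange ℝ p + (1 : ℝ) ⊗ₜ[ℤ] u.trans
  one_smul p := by
    change (weylAct P 1).toLinearMap.baseChange ℝ p + (1 : ℝ) ⊗ₜ[ℤ] (0 : Y) = p
    rw [map_one, tmul_zero, add_zero]
    exact LinearMap.congr_fun (LinearMap.baseChange_id (R := ℤ) (A := ℝ) (M := Y)) p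
  mul_smul u v p := by
    change (weylAct P (u.lin * v.lin)).toLinearMap.baseChange ℝ p
        + (1 : ℝ) ⊗ₜ[ℤ] (u.trans + weylAct P u.lin v.trans)
      = (weylAct P u.lin).toLinearMap.baseChange ℝ
          ((weylAct P v.lin).toLinearMap.baseChange ℝ p + (1 : ℝ) ⊗ₜ[ℤ] v.trans)
        + (1 : ℝ) ⊗ₜ[ℤ] u.trans
    have h : (weylAct P (u.lin * v.lin)).toLinearMap.baseChange ℝ p
        = (weylAct P u.lin).toLinearMap.baseChange ℝ
            ((weylAct P v.lin).toLinearMap.baseChange ℝ p) := by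
      rw [map_mul]
      exact LinearMap.congr_fun (LinearMap.baseChange_comp (A := ℝ)
        (f := (weylAct P v.lin).toLinearMap) (weylAct P u.lin).toLinearMap) p
    rw [h, map_add, LinearMap.baseChange_tmul, tmul_add]
    simp only [LinearEquiv.coe_coe]
    abel

/-- The root with index `i` as a linear form on the apartment. -/
noncomputable def rootForm (i : ι) : Apartment Y →ₗ[ℝ] ℝ :=
  LinearMap.liftBaseChange ℝ ((Algebra.linearMap ℤ ℝ).comp (P.root' i))

/-- The affine root hyperplane `{p | ⟨α_i, p⟩ = k}`. -/
def hyperplane (i : ι) (k : ℤ) : Set (Apartment Y) := {p | rootForm P i p = k}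

/-- The facet through `p`: the points that lie, for each affine root hyperplane, on this hyperplane
if `p` does, and otherwise strictly on the same side of it as `p`. -/
def facetOf (p : Apartment Y) : Set (Apartment Y) :=
  {q | ∀ (i : ι) (k : ℤ), SignType.sign (rootForm P i q - k) = SignType.sign (rootForm P i p - k)}

/-- Facets of the apartment. -/
def IsFacet (f : Set (Apartment Y)) : Prop := ∃ p, f = facetOf P p

/-- Alcoves: the facets that are not contained in any affine root hyperplane. -/
def IsAlcove (a : Set (Apartment Y)) : Prop :=
  IsFacet P a ∧ ∀ (i : ι) (k : ℤ), ¬ a ⊆ hyperplane P i k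

/-- The relation `f ⊆ closure f'`, the closure being taken for the usual topology of the
finite-dimensional real vector space `X_* ⊗ ℝ`. For facets, this says that `f` is a subfacet of
`f'`. -/
def IsSubfacet (f f' : Set (Apartment Y)) : Prop :=
  letI : TopologicalSpace (Apartment Y) := moduleTopology ℝ (Apartment Y)
  f ⊆ closure f'

/-- The reflection `t_{k α^∨} s_α` across the affine root hyperplane `⟨α, p⟩ = k`, `α = α_i`. -/
noncomputable def affineReflection (i : ι) (k : ℤ) : ExtAffineWeyl P :=
  ExtAffineWeyl.mk P (k • P.coroot i) (RootPairing.weylGroup.ofIdx P i)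

/-- The affine Weyl group, as a subgroup of the extended affine Weyl group. -/
noncomputable def affineWeyl : Subgroup (ExtAffineWeyl P) :=
  Subgroup.closure {s | ∃ i k, s = affineReflection P i k}

/-- `⟨α_i, p⟩ = k` is a wall of `a`: it is the support of a subfacet `f` of `a`, that is, it is the
one and only affine root hyperplane that contains `f`. -/
def IsWall (a : Set (Apartment Y)) (i : ι) (k : ℤ) : Prop :=
  ∃ f, IsFacet P f ∧ IsSubfacet f a ∧ f ⊆ hyperplane P i k ∧
    ∀ (j : ι) (l : ℤ), f ⊆ hyperplane P j l → hyperplane P j l = hyperplane P i k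

/-- The set `Π_a` of reflections across the walls of `a`. -/
def simpleReflections (a : Set (Apartment Y)) : Set (ExtAffineWeyl P) :=
  {s | ∃ i k, IsWall P a i k ∧ s = affineReflection P i k}

/-- The stabilizer `Ω_a` of `a` in the extended affine Weyl group. -/
noncomputable def alcoveStab (a : Set (Apartment Y)) : Subgroup (ExtAffineWeyl P) :=
  MulAction.stabilizer (ExtAffineWeyl P) a

/-- The stabilizer `W_f` of `f` in the affine Weyl group. -/
noncomputable def facetStab (f : Set (Apartment Y)) : Subgroup (ExtAffineWeyl P) :=
  affineWeyl P ⊓ MulAction.stabilizer (ExtAffineWeyl P) f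

/-- The length function on the extended affine Weyl group determined by the alcove `a`:
`ℓ(w τ) = ℓ(w)` for `w` in the affine Weyl group and `τ` in `Ω_a`. -/
noncomputable def length (a : Set (Apartment Y)) (u : ExtAffineWeyl P) : ℕ :=
  sInf {n | ∃ w ∈ affineWeyl P, ∃ τ ∈ alcoveStab P a, u = w * τ ∧
    n = wordLength (simpleReflections P a) w}

/-- The Bruhat order on the extended affine Weyl group determined by the alcove `a`:
`w τ ≤ w' τ'` if and only if `τ = τ'` and `w ≤ w'`, for `w`, `w'` in the affine Weyl group and
`τ`, `τ'` in `Ω_a`. -/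
def BruhatLE (a : Set (Apartment Y)) (u v : ExtAffineWeyl P) : Prop :=
  ∃ w ∈ affineWeyl P, ∃ w' ∈ affineWeyl P, ∃ τ ∈ alcoveStab P a,
    u = w * τ ∧ v = w' * τ ∧ CoxeterBruhatLE (simpleReflections P a) w w'

/-- The double coset space `W_{f₁} \ (X_* ⋊ W) / W_{f₂}`. -/
abbrev DoubleCosets (f₁ f₂ : Set (Apartment Y)) : Type _ :=
  DoubleCoset.Quotient (facetStab P f₁ : Set (ExtAffineWeyl P))
    (facetStab P f₂ : Set (ExtAffineWeyl P))

variable {P} in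
/-- `u` is an element of minimal length of the double coset `D`. -/
def IsMinRep (a : Set (Apartment Y)) {f₁ f₂ : Set (Apartment Y)} (D : DoubleCosets P f₁ f₂)
    (u : ExtAffineWeyl P) : Prop :=
  DoubleCoset.mk (facetStab P f₁) (facetStab P f₂) u = D ∧
    ∀ v, DoubleCoset.mk (facetStab P f₁) (facetStab P f₂) v = D → length P a u ≤ length P a v

variable {P} in
/-- The Bruhat order on double cosets determined by the alcove `a`: the Bruhat order between the
(unique) elements of minimal length. -/
def DoubleCosetBruhatLE (a : Set (Apartment Y)) {f₁ f₂ : Set (Apartment Y)}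
    (D E : DoubleCosets P f₁ f₂) : Prop :=
  ∃ u v, IsMinRep a D u ∧ IsMinRep a E v ∧ BruhatLE P a u v

end RootDatum

/-! ## Automorphisms of a based root datum and Steinberg fixed-point root data -/

section Steinberg

variable {ι X Y : Type*} [AddCommGroup X] [AddCommGroup Y]

/-- The automorphism `Θ^*` of `X^*` dual to an automorphism `Θ` of `X_*`:
`⟨Θ^* x, y⟩ = ⟨x, Θ y⟩`. -/
noncomputable def dualAut (P : RootDatum ι X Y) (Θ : Y ≃ₗ[ℤ] Y) : X ≃ₗ[ℤ] X :=
  P.toPerfPair ≪≫ₗ Θ.dualMap ≪≫ₗ P.toPerfPair.symm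

theorem dualAut_apply (P : RootDatum ι X Y) (Θ : Y ≃ₗ[ℤ] Y) (x : X) (y : Y) :
    P.toLinearMap (dualAut P Θ x) y = P.toLinearMap x (Θ y) := by
  have h : P.toPerfPair (dualAut P Θ x) = Θ.dualMap (P.toPerfPair x) := by
    simp [dualAut]
  exact LinearMap.congr_fun h y

/-- An automorphism of the based root datum `(P, b)`: an automorphism `Θ` of `X_*` that stabilizes
the set of coroots and whose dual `Θ^*` stabilizes the set of roots and the set of simple roots. -/
structure BasedAut (P : RootDatum ι X Y) (b : P.Base) where
  /-- The underlying automorphism of `X_*`. -/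
  toEquiv : Y ≃ₗ[ℤ] Y
  image_coroot : toEquiv '' range P.coroot = range P.coroot
  image_root : dualAut P toEquiv '' range P.root = range P.root
  image_simple : dualAut P toEquiv '' (P.root '' b.support) = P.root '' b.support

variable {P : RootDatum ι X Y} {b : P.Base} (Θ : BasedAut P b)

/-- The cocharacter group `X_*^{[Θ]} = {y ∈ X_* | Θ y ≡ y mod Z}`, where `Z` is the group of
cocharacters that pair to zero with all the roots. -/
def fixedCochar : Submodule ℤ Y where
  carrier := {y | ∀ i, P.root' i (Θ.toEquiv y - y) = 0}
  zero_mem' i := by simp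
  add_mem' {x y} hx hy i := by
    have h : Θ.toEquiv (x + y) - (x + y) = (Θ.toEquiv x - x) + (Θ.toEquiv y - y) := by
      rw [map_add]; abel
    rw [h, map_add, hx i, hy i, add_zero]
  smul_mem' c y hy i := by
    rw [map_smul, ← smul_sub, map_smul, hy i, smul_zero]

/-- The restriction to `X_*^{[Θ]}` of a root. The group `Hom(X_*^{[Θ]}, ℤ)` is the character group
`X^{*[Θ]}`. -/
noncomputable def resRoot (i : ι) : Dual ℤ (fixedCochar Θ) :=
  (P.root' i).comp (fixedCochar Θ).subtype

/-- The set `R^{[Θ]}`: the restrictions `a` of roots to `X_*^{[Θ]}` such that `2 a` is not also the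
restriction of a root. -/
def fixedRoots : Set (Dual ℤ (fixedCochar Θ)) :=
  {a | a ∈ range (resRoot Θ) ∧ 2 • a ∉ range (resRoot Θ)}

/-- The sum of the coroots of all the roots that restrict to `a`. (The roots that restrict to
`a ∈ R^{[Θ]}` form a single orbit under `Θ`, and are pairwise orthogonal.) -/
noncomputable def sumCoroot (a : Dual ℤ (fixedCochar Θ)) : Y :=
  ∑ᶠ i ∈ {i | resRoot Θ i = a}, P.coroot i

section Construction

theorem apply_root_injective (P : RootDatum ι X Y) {x x' : X}
    (h : ∀ y, P.toLinearMap x y = P.toLinearMap x' y) : x = x' :=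
  P.toPerfPair.injective (LinearMap.ext h)

/-- `Θ` permutes the coroots and the roots compatibly. -/
theorem BasedAut.exists_perm [Finite ι] :
    ∃ σ : Equiv.Perm ι, ∀ i, P.root (σ i) = dualAut P Θ.toEquiv (P.root i) ∧
      Θ.toEquiv (P.coroot (σ i)) = P.coroot i := by
  have : IsReflexive ℤ X := .of_isPerfPair P.toLinearMap
  have : IsAddTorsionFree X := .of_isTorsionFree ℤ X
  have h1 : ∀ i, ∃ j, P.root j = dualAut P Θ.toEquiv (P.root i) := fun i ↦ by
    have : dualAut P Θ.toEquiv (P.root i) ∈ range P.root := by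
      rw [← Θ.image_root]; exact mem_image_of_mem _ (mem_range_self i)
    exact this
  choose f hf using h1
  have hfi : Function.Injective f := fun i j hij ↦ by
    have := hf i
    rw [hij, hf j] at this
    exact (P.root.injective ((dualAut P Θ.toEquiv).injective this)).symm
  refine ⟨Equiv.ofBijective f (Finite.injective_iff_bijective.mp hfi), fun i ↦ ⟨hf i, ?_⟩⟩
  change Θ.toEquiv (P.coroot (f i)) = P.coroot i
  have h2 : P.coroot i ∈ Θ.toEquiv '' range P.coroot := by
    rw [Θ.image_coroot]; exact mem_range_self i
  obtain ⟨_, ⟨m, rfl⟩, hm⟩ := h2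
  have key : P.root (f i) = P.root m := by
    refine Module.eq_of_mapsTo_reflection_of_mem (f := P.coroot' m) (g := P.coroot' m)
      (Φ := range P.root) (finite_range _) ?_ ?_ ?_ ?_ ?_ (P.mapsTo_reflection_root m)
      (mem_range_self m)
    · change P.toLinearMap (P.root (f i)) (P.coroot m) = 2
      rw [hf, dualAut_apply, hm]; exact P.root_coroot_two i
    · exact P.root_coroot_two m
    · change P.toLinearMap (P.root (f i)) (P.coroot m) = 2
      rw [hf, dualAut_apply, hm]; exact P.root_coroot_two i
    · exact P.root_coroot_two m
    · rintro x hx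
      rw [← Θ.image_root] at hx
      obtain ⟨_, ⟨j, rfl⟩, rfl⟩ := hx
      rw [← Θ.image_root]
      refine ⟨P.reflection i (P.root j), P.mapsTo_reflection_root i (mem_range_self j), ?_⟩
      rw [preReflection_apply, P.reflection_apply, map_sub, map_smul, hf]
      congr 2
      change P.toLinearMap (P.root j) (P.coroot i)
        = P.toLinearMap (dualAut P Θ.toEquiv (P.root j)) (P.coroot m)
      rw [dualAut_apply, hm]
  rw [P.root.injective key, hm]

theorem sum_height_eq_zero (b : P.Base) {κ : Type*} (s : Finset κ) (g : κ → ι)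
    (h : ∑ k ∈ s, P.root (g k) = 0) : ∑ k ∈ s, b.height (g k) = 0 := by
  choose F _ _ hF using fun i ↦ b.exists_root_eq_sum_int i
  have h1 : ∑ j ∈ b.support, (∑ k ∈ s, F (g k) j) • P.root j = 0 := by
    rw [← h]
    simp_rw [Finset.sum_smul]
    rw [Finset.sum_comm]
    exact Finset.sum_congr rfl fun k _ ↦ (hF (g k)).symm
  have h2 := linearIndepOn_finset_iff.mp b.linearIndepOn_root _ h1
  have h3 : ∀ k, b.height (g k) = ∑ j ∈ b.support, F (g k) j := fun k ↦
    RootPairing.Base.height_eq_sum (hF (g k))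
  simp_rw [h3]
  rw [Finset.sum_comm]
  exact Finset.sum_eq_zero h2

instance : IsAddTorsionFree (Dual ℤ (fixedCochar Θ)) := .of_isTorsionFree ℤ _

/-- No root restricts to zero. -/
theorem resRoot_ne_zero [Finite ι] (i : ι) : resRoot Θ i ≠ 0 := by
  classical
  obtain ⟨σ, hσ⟩ := Θ.exists_perm
  have hpos : ∀ i, b.IsPos i → b.IsPos (σ i) := fun i hi ↦ by
    refine hi.induction_on_add (p := fun i ↦ b.IsPos (σ i)) (fun j hj ↦ ?_)
      fun j k l h hj hk ↦ ?_
    · apply RootPairing.Base.isPos_of_mem_support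
      have : P.root (σ j) ∈ P.root '' b.support := by
        rw [(hσ j).1, ← Θ.image_simple]
        exact mem_image_of_mem _ (mem_image_of_mem _ hj)
      obtain ⟨m, hm, h⟩ := this
      exact P.root.injective h ▸ hm
    · have hk' : b.IsPos (σ k) := by
        apply RootPairing.Base.isPos_of_mem_support
        have : P.root (σ k) ∈ P.root '' b.support := by
          rw [(hσ k).1, ← Θ.image_simple]
          exact mem_image_of_mem _ (mem_image_of_mem _ hk)
        obtain ⟨m, hm, h⟩ := this
        exact P.root.injective h ▸ hm
      refine hj.add hk' ?_
      rw [(hσ _).1, (hσ _).1, (hσ _).1, h, map_add]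
  suffices H : ∀ i, b.IsPos i → resRoot Θ i ≠ 0 by
    let _ := P.indexNeg
    rcases RootPairing.Base.IsPos.or_neg b i with h | h
    · exact H i h
    · intro h0
      refine H _ h ?_
      ext y
      have h1 : P.root' i (y : Y) = 0 := LinearMap.congr_fun h0 y
      change P.toLinearMap (P.root (-i)) (y : Y) = 0
      have h2 : P.root (-i) = -P.root i := by simp
      rw [h2, map_neg, LinearMap.neg_apply, neg_eq_zero]
      exact h1
  intro i hi h0
  set N := orderOf σ with hN
  have hN0 : 0 < N := orderOf_pos σ
  have hpow : ∀ k j, ∀ y, P.root' (((σ ^ k : Equiv.Perm ι)) j) y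
      = P.root' j ((Θ.toEquiv ^ k : Y ≃ₗ[ℤ] Y) y) := by
    intro k
    induction k with
    | zero => intro j y; simp
    | succ k ih =>
      intro j y
      rw [pow_succ', Equiv.Perm.mul_apply, pow_succ, LinearEquiv.mul_apply, ← ih j]
      change P.toLinearMap (P.root (σ ((σ ^ k : Equiv.Perm ι) j))) y = _
      rw [(hσ _).1, dualAut_apply]
  have hsum : ∑ k ∈ Finset.range N, P.root ((σ ^ k : Equiv.Perm ι) i) = 0 := by
    refine apply_root_injective P fun y ↦ ?_
    have hy : (∑ k ∈ Finset.range N, (Θ.toEquiv ^ k : Y ≃ₗ[ℤ] Y) y) ∈ fixedCochar Θ := by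
      intro j
      have : Θ.toEquiv (∑ k ∈ Finset.range N, (Θ.toEquiv ^ k : Y ≃ₗ[ℤ] Y) y)
          - ∑ k ∈ Finset.range N, (Θ.toEquiv ^ k : Y ≃ₗ[ℤ] Y) y
          = (Θ.toEquiv ^ N : Y ≃ₗ[ℤ] Y) y - (Θ.toEquiv ^ 0 : Y ≃ₗ[ℤ] Y) y := by
        rw [map_sum, ← Finset.sum_sub_distrib,
          ← Finset.sum_range_sub (fun k ↦ (Θ.toEquiv ^ k : Y ≃ₗ[ℤ] Y) y)]
        exact Finset.sum_congr rfl fun k _ ↦ by rw [pow_succ', LinearEquiv.mul_apply]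
      rw [this, map_sub, ← hpow, ← hpow, hN, pow_orderOf_eq_one, pow_zero, sub_self]
    have h1 : P.root' i (∑ k ∈ Finset.range N, (Θ.toEquiv ^ k : Y ≃ₗ[ℤ] Y) y) = 0 :=
      LinearMap.congr_fun h0 ⟨_, hy⟩
    rw [map_sum] at h1
    rw [map_sum, LinearMap.sum_apply, map_zero, LinearMap.zero_apply, ← h1]
    exact Finset.sum_congr rfl fun k _ ↦ hpow k i y
  have h2 := sum_height_eq_zero b _ _ hsum
  have h3 : ∀ k, b.IsPos ((σ ^ k : Equiv.Perm ι) i) := by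
    intro k
    induction k with
    | zero => simpa using hi
    | succ k ih => rw [pow_succ', Equiv.Perm.mul_apply]; exact hpos _ ih
  have h4 : 0 < ∑ k ∈ Finset.range N, b.height ((σ ^ k : Equiv.Perm ι) i) :=
    Finset.sum_pos (fun k _ ↦ h3 k) ⟨0, Finset.mem_range.mpr hN0⟩
  exact h4.ne' h2

/-- Two different roots with the same restriction `a ∈ R^{[Θ]}` are orthogonal. -/
theorem pairing_eq_zero_of_resRoot_eq [Finite ι] {i j : ι} (hij : i ≠ j)
    (h : resRoot Θ i = resRoot Θ j) (h2 : resRoot Θ j ∈ fixedRoots Θ) : P.pairing i j = 0 := by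
  refine P.pairing_eq_zero_of_add_notMem_of_sub_notMem hij ?_ ?_ ?_
  · intro h1
    refine resRoot_ne_zero Θ j ?_
    have h3 : resRoot Θ i = - resRoot Θ j := by
      ext y
      change P.toLinearMap (P.root i) (y : Y) = - P.toLinearMap (P.root j) (y : Y)
      rw [h1, map_neg, LinearMap.neg_apply]
    rw [h] at h3
    exact self_eq_neg.mp h3
  · rintro ⟨k, hk⟩
    refine h2.2 ⟨k, ?_⟩
    rw [two_smul]
    nth_rewrite 1 [← h]
    ext y
    change P.toLinearMap (P.root k) (y : Y)
      = P.toLinearMap (P.root i) (y : Y) + P.toLinearMap (P.root j) (y : Y)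
    rw [hk, map_add, LinearMap.add_apply]
  · rintro ⟨k, hk⟩
    refine resRoot_ne_zero Θ k ?_
    rw [← sub_eq_zero.mpr h]
    ext y
    change P.toLinearMap (P.root k) (y : Y)
      = P.toLinearMap (P.root i) (y : Y) - P.toLinearMap (P.root j) (y : Y)
    rw [hk, map_sub, LinearMap.sub_apply]

/-- The product of the reflections in pairwise orthogonal roots. -/
theorem exists_perm_of_orthogonal (P : RootDatum ι X Y) (s : Finset ι)
    (hs : ∀ i ∈ s, ∀ j ∈ s, i ≠ j → P.pairing i j = 0) :
    ∃ σ : Equiv.Perm ι, ∀ j,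
      P.root (σ j) = P.root j - ∑ i ∈ s, P.pairing j i • P.root i ∧
      P.coroot (σ j) = P.coroot j - ∑ i ∈ s, P.pairing i j • P.coroot i := by
  classical
  induction s using Finset.induction_on with
  | empty => exact ⟨1, fun j ↦ by simp⟩
  | insert k s hk ih =>
    obtain ⟨σ, hσ⟩ := ih fun i hi j hj ↦
      hs i (Finset.mem_insert_of_mem hi) j (Finset.mem_insert_of_mem hj)
    refine ⟨P.reflectionPerm k * σ, fun j ↦ ⟨?_, ?_⟩⟩
    · rw [Equiv.Perm.mul_apply, ← P.reflectionPerm_root, Finset.sum_insert hk, (hσ j).1]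
      have h0 : P.toLinearMap (∑ i ∈ s, P.pairing j i • P.root i) (P.coroot k) = 0 := by
        rw [map_sum, LinearMap.sum_apply]
        refine Finset.sum_eq_zero fun i hi ↦ ?_
        rw [map_smul, LinearMap.smul_apply, P.root_coroot_eq_pairing,
          hs i (Finset.mem_insert_of_mem hi) k (Finset.mem_insert_self _ _)
            (fun h ↦ hk (h ▸ hi)), smul_zero]
      rw [map_sub, LinearMap.sub_apply, h0, sub_zero, P.root_coroot_eq_pairing]
      abel
    · rw [Equiv.Perm.mul_apply, ← P.reflectionPerm_coroot, Finset.sum_insert hk, (hσ j).2]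
      have h0 : P.toLinearMap (P.root k) (∑ i ∈ s, P.pairing i j • P.coroot i) = 0 := by
        rw [map_sum]
        refine Finset.sum_eq_zero fun i hi ↦ ?_
        rw [map_smul, P.root_coroot_eq_pairing,
          hs k (Finset.mem_insert_self _ _) i (Finset.mem_insert_of_mem hi)
            (fun h ↦ hk (h ▸ hi)), smul_zero]
      rw [map_sub, h0, sub_zero, P.root_coroot_eq_pairing]
      abel

open Classical in
theorem sumCoroot_eq [Fintype ι] (a : Dual ℤ (fixedCochar Θ)) :
    sumCoroot Θ a = ∑ i with resRoot Θ i = a, P.coroot i := by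
  rw [sumCoroot, finsum_mem_eq_finite_toFinset_sum _ (toFinite _)]
  exact Finset.sum_congr (by ext; simp) fun _ _ ↦ rfl

theorem sumCoroot_mem [Finite ι] (a : Dual ℤ (fixedCochar Θ)) :
    sumCoroot Θ a ∈ fixedCochar Θ := by
  classical
  have := Fintype.ofFinite ι
  obtain ⟨σ, hσ⟩ := Θ.exists_perm
  have hres : ∀ i, resRoot Θ (σ i) = resRoot Θ i := fun i ↦ by
    ext y
    change P.toLinearMap (P.root (σ i)) (y : Y) = P.toLinearMap (P.root i) (y : Y)
    rw [(hσ i).1, dualAut_apply, ← sub_eq_zero, ← map_sub]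
    exact y.2 i
  have h : Θ.toEquiv (sumCoroot Θ a) = sumCoroot Θ a := by
    rw [sumCoroot_eq, map_sum, Finset.sum_filter, Finset.sum_filter, ← Equiv.sum_comp σ]
    exact Finset.sum_congr rfl fun i _ ↦ by rw [hres, (hσ i).2]
  intro i
  rw [h, sub_self, map_zero]

/-- The coroot `a^∨` of `a ∈ R^{[Θ]}`, as an element of `X_*^{[Θ]}`. -/
noncomputable def fixedCoroot [Finite ι] (a : Dual ℤ (fixedCochar Θ)) : fixedCochar Θ :=
  ⟨sumCoroot Θ a, sumCoroot_mem Θ a⟩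

open Classical in
theorem resRoot_fixedCoroot [Fintype ι] (j : ι) (a : Dual ℤ (fixedCochar Θ)) :
    resRoot Θ j (fixedCoroot Θ a) = ∑ i with resRoot Θ i = a, P.pairing j i := by
  change P.root' j (sumCoroot Θ a) = _
  rw [sumCoroot_eq, map_sum]
  rfl

theorem fixedRoot_coroot_two [Finite ι] {a : Dual ℤ (fixedCochar Θ)} (ha : a ∈ fixedRoots Θ) :
    a (fixedCoroot Θ a) = 2 := by
  classical
  have := Fintype.ofFinite ι
  obtain ⟨k, rfl⟩ := ha.1
  rw [resRoot_fixedCoroot, Finset.sum_eq_single_of_mem k (by simp)]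
  · exact P.root_coroot_two k
  · intro i hi hik
    exact pairing_eq_zero_of_resRoot_eq Θ hik.symm (by simpa using (Finset.mem_filter.mp hi).2.symm)
      (by rw [(Finset.mem_filter.mp hi).2]; exact ha)

open Classical in
/-- The reflection in `a ∈ R^{[Θ]}` lifts to a permutation of the roots and coroots of `R`. -/
theorem exists_lift [Fintype ι] {a : Dual ℤ (fixedCochar Θ)} (ha : a ∈ fixedRoots Θ) :
    ∃ σ : Equiv.Perm ι, ∀ j,
      resRoot Θ (σ j) = resRoot Θ j - resRoot Θ j (fixedCoroot Θ a) • a ∧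
      P.coroot (σ j)
        = P.coroot j - ∑ i with resRoot Θ i = a, P.pairing i j • P.coroot i := by
  obtain ⟨σ, hσ⟩ := exists_perm_of_orthogonal P {i | resRoot Θ i = a} (by
    intro i hi j hj hij
    have hi' := (Finset.mem_filter.mp hi).2
    have hj' := (Finset.mem_filter.mp hj).2
    exact pairing_eq_zero_of_resRoot_eq Θ hij (hi'.trans hj'.symm) (hj' ▸ ha))
  refine ⟨σ, fun j ↦ ⟨?_, (hσ j).2⟩⟩
  ext y
  change P.toLinearMap (P.root (σ j)) (y : Y)
    = P.toLinearMap (P.root j) (y : Y) - resRoot Θ j (fixedCoroot Θ a) * a y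
  rw [(hσ j).1, map_sub, LinearMap.sub_apply, resRoot_fixedCoroot, map_sum, LinearMap.sum_apply,
    Finset.sum_mul]
  congr 1
  refine Finset.sum_congr rfl fun i hi ↦ ?_
  rw [map_smul, LinearMap.smul_apply, ← (Finset.mem_filter.mp hi).2]
  rfl

theorem fixed_refl_refl [Finite ι] {a : Dual ℤ (fixedCochar Θ)} (ha : a ∈ fixedRoots Θ)
    (c : Dual ℤ (fixedCochar Θ)) :
    (c - c (fixedCoroot Θ a) • a)
      - (c - c (fixedCoroot Θ a) • a) (fixedCoroot Θ a) • a = c := by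
  rw [LinearMap.sub_apply, LinearMap.smul_apply, fixedRoot_coroot_two Θ ha, smul_eq_mul]
  module

theorem fixedRoots_refl [Finite ι] {a c : Dual ℤ (fixedCochar Θ)} (ha : a ∈ fixedRoots Θ)
    (hc : c ∈ fixedRoots Θ) : c - c (fixedCoroot Θ a) • a ∈ fixedRoots Θ := by
  classical
  have := Fintype.ofFinite ι
  obtain ⟨σ, hσ⟩ := exists_lift Θ ha
  obtain ⟨⟨j, rfl⟩, hc2⟩ := hc
  refine ⟨⟨σ j, (hσ j).1⟩, ?_⟩
  rintro ⟨k, hk⟩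
  refine hc2 ⟨σ k, ?_⟩
  rw [(hσ k).1, hk, LinearMap.smul_apply, smul_assoc, ← smul_sub, fixed_refl_refl Θ ha]

theorem fixedCoroot_refl [Finite ι] {a c : Dual ℤ (fixedCochar Θ)} (ha : a ∈ fixedRoots Θ) :
    fixedCoroot Θ (c - c (fixedCoroot Θ a) • a)
      = fixedCoroot Θ c - a (fixedCoroot Θ c) • fixedCoroot Θ a := by
  classical
  have := Fintype.ofFinite ι
  obtain ⟨σ, hσ⟩ := exists_lift Θ ha
  apply Subtype.ext
  change sumCoroot Θ _ = sumCoroot Θ c - a (fixedCoroot Θ c) • sumCoroot Θ a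
  have h1 : sumCoroot Θ (c - c (fixedCoroot Θ a) • a)
      = ∑ j with resRoot Θ j = c, P.coroot (σ j) := by
    rw [sumCoroot_eq, Finset.sum_filter, Finset.sum_filter, ← Equiv.sum_comp σ]
    refine Finset.sum_congr rfl fun j _ ↦ ?_
    congr 1
    apply propext
    rw [(hσ j).1]
    constructor
    · intro h
      rw [← fixed_refl_refl Θ ha (resRoot Θ j), h, fixed_refl_refl Θ ha]
    · rintro rfl
      rfl
  rw [h1, Finset.sum_congr rfl fun j _ ↦ (hσ j).2, Finset.sum_sub_distrib, ← sumCoroot_eq,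
    Finset.sum_comm, sumCoroot_eq Θ a, Finset.smul_sum]
  congr 1
  refine Finset.sum_congr rfl fun i hi ↦ ?_
  rw [← Finset.sum_smul, ← (Finset.mem_filter.mp hi).2, resRoot_fixedCoroot]

theorem fixedCoroot_injOn [Finite ι] : InjOn (fixedCoroot Θ) (fixedRoots Θ) := by
  intro a ha c hc h
  have hfin : (fixedRoots Θ).Finite := (finite_range (resRoot Θ)).subset fun a ha ↦ ha.1
  refine Module.eq_of_mapsTo_reflection_of_mem
    (f := Dual.eval ℤ (fixedCochar Θ) (fixedCoroot Θ a))
    (g := Dual.eval ℤ (fixedCochar Θ) (fixedCoroot Θ c)) hfin (fixedRoot_coroot_two Θ ha)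
    (fixedRoot_coroot_two Θ hc) ?_ ?_ (fun x hx ↦ fixedRoots_refl Θ ha hx)
    (fun x hx ↦ fixedRoots_refl Θ hc hx) hc
  · rw [← h]; exact fixedRoot_coroot_two Θ ha
  · rw [h]; exact fixedRoot_coroot_two Θ hc

/-- The Steinberg fixed-point root datum `R^{[Θ]}`, with cocharacter group `X_*^{[Θ]}`, character
group its dual, roots `R^{[Θ]}`, and coroots `a^∨`. -/
noncomputable def steinberg [Finite ι] [Module.Finite ℤ Y] :
    RootDatum (fixedRoots Θ) (Dual ℤ (fixedCochar Θ)) (fixedCochar Θ) :=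
  haveI : IsReflexive ℤ Y := .of_isPerfPair P.flip.toLinearMap
  haveI : Finite (fixedRoots Θ) :=
    ((finite_range (resRoot Θ)).subset fun _ ha ↦ ha.1).to_subtype
  RootPairing.mk' (LinearMap.id : Dual ℤ (fixedCochar Θ) →ₗ[ℤ] Dual ℤ (fixedCochar Θ))
    ⟨Subtype.val, Subtype.val_injective⟩
    ⟨fun a ↦ fixedCoroot Θ a, fun a c h ↦ Subtype.ext (fixedCoroot_injOn Θ a.2 c.2 h)⟩
    (fun a ↦ fixedRoot_coroot_two Θ a.2)
    (by
      rintro a _ ⟨c, rfl⟩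
      exact ⟨⟨_, fixedRoots_refl Θ a.2 c.2⟩, rfl⟩)
    (by
      rintro a _ ⟨c, rfl⟩
      exact ⟨⟨_, fixedRoots_refl Θ a.2 c.2⟩, fixedCoroot_refl Θ a.2⟩)

end Construction

/-- The inclusion of apartments `X_*^{[Θ]} ⊗ ℝ → X_* ⊗ ℝ`. -/
noncomputable def fixedIncl : Apartment (fixedCochar Θ) →ₗ[ℝ] Apartment Y :=
  (fixedCochar Θ).subtype.baseChange ℝ

/-- The intersection `f^{[Θ]} = f ∩ (X_*^{[Θ]} ⊗ ℝ)`, as a subset of `X_*^{[Θ]} ⊗ ℝ`. -/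
def fixedPart (f : Set (Apartment Y)) : Set (Apartment (fixedCochar Θ)) := fixedIncl Θ ⁻¹' f

/-- `j` realizes the extended affine Weyl group of `R^{[Θ]}` inside the one of `R`: the affine
transformation `j u` of `X_* ⊗ ℝ` restricts to the affine transformation `u` of
`X_*^{[Θ]} ⊗ ℝ`, for all `u`. -/
def IsNaturalInclusion [Finite ι] [Module.Finite ℤ Y]
    (j : ExtAffineWeyl (steinberg Θ) →* ExtAffineWeyl P) : Prop :=
  ∀ (u : ExtAffineWeyl (steinberg Θ)) (p : Apartment (fixedCochar Θ)),
    fixedIncl Θ (u • p) = j u • fixedIncl Θ p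

end Steinberg

end SteinbergRootDatum

open SteinbergRootDatum

namespace SteinbergRootDatum

open Set Module TensorProduct Filter Topology
open scoped Pointwise

/-! ### Action on the apartment, affine roots, sides of hyperplanes -/

section Apartment

variable {ι X Y : Type*} [AddCommGroup X] [AddCommGroup Y] (P : RootDatum ι X Y)

/-! Everything is rephrased in terms of points. A facet is given by its signs with respect to all
affine root hyperplanes, so an alcove that meets A^[Θ] is the facet of a generic point p of A^[Θ],
and f₁, f₂ are the facets of points x₁, x₂ of A^[Θ]. The reflection t across H shortens u exactly
when H separates p from u p (`length_affineReflection_mul_lt_iff`). Hence the Bruhat order on the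
extended group is generated by the steps u → t u for which H does not separate p from u p
(`bruhatLE_iff`). The minimal element of a double coset is the u for which no hyperplane through x₁
separates p from u p and none through x₂ separates p from u⁻¹ p (`isMinRep_iff`, `IsBiminimal.eq`).

Every restricted root has a positive multiple in R^[Θ], so the hyperplanes of R^[Θ] are the traces
on A^[Θ] of those of R, with matching sides (`sameSide_steinberg`). Therefore j sends minimal
representatives to minimal representatives (`IsNaturalInclusion.isBiminimal`). Uniqueness of these
gives injectivity on double cosets, and it remains to compare the orders on group elements.

j preserves the order: a reflection of R^[Θ] lifts to a product of reflections of R in pairwise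
orthogonal roots, whose hyperplanes all have the same trace, so one step lifts to a chain of steps
(`exists_lift_affineReflection`).

j reflects the order (`IsNaturalInclusion.bruhatRel_of_map`): let j u ≤ j v and induct on the length
of v. Take a wall of the alcove of p in A^[Θ] that separates p from v p, its reflection t, and a
point x of it on no other hyperplane of R^[Θ]. Then j t lies in the stabilizer W_x of the facet of x
in W_aff, and j z is minimal in W_x j z whenever z p is on the side of p. Minimal elements of left
W_x-cosets inherit the order (`BruhatRel.minimal_mono`), so j u' ≤ j (t v), where u' is whichever of
u, t u is on the side of p. By induction u' ≤ t v. If u' = u, then u ≤ t v < v; if u' = t u, the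
lifting property `BruhatRel.affineReflection_mul` gives u ≤ v. -/

theorem smul_eq (u : ExtAffineWeyl P) (p : Apartment Y) :
    u • p = (weylAct P u.lin).toLinearMap.baseChange ℝ p + (1 : ℝ) ⊗ₜ[ℤ] u.trans := rfl

/-- The permutation is the one carried by the automorphism `g` itself. The coweight map is
contravariant and `weylAct` is its inverse, so transposition moves the action across the pairing. -/
theorem exists_perm_weylAct (w : P.weylGroup) :
    ∃ σ : Equiv.Perm ι, (∀ i y, P.root' (σ i) (weylAct P w y) = P.root' i y) ∧
      ∀ i, weylAct P w (P.coroot i) = P.coroot (σ i) := by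
  obtain ⟨g, hg⟩ := w
  set z : Y ≃ₗ[ℤ] Y := RootPairing.Equiv.coweightEquiv P P g with hz
  have hw : weylAct P ⟨g, hg⟩ = z⁻¹ := rfl
  have hcw : ∀ y, g.coweightMap ((z⁻¹ : Y ≃ₗ[ℤ] Y) y) = y := fun y ↦ z.apply_symm_apply y
  refine ⟨g.indexEquiv, fun i y ↦ ?_, fun i ↦ ?_⟩
  · rw [hw]
    have h1 := RootPairing.Hom.root_weightMap_apply (f := g.toHom) (i := i)
    have h2 := LinearMap.congr_fun₂ g.weight_coweight_transpose ((z⁻¹ : Y ≃ₗ[ℤ] Y) y) (P.root i)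
    simp only [LinearMap.dualMap_apply, LinearMap.coe_comp, Function.comp_apply] at h2
    change P.toLinearMap (P.root (g.indexEquiv i)) _ = P.toLinearMap (P.root i) y
    rw [← h1]
    change P.toLinearMap (g.weightMap (P.root i)) ((z⁻¹ : Y ≃ₗ[ℤ] Y) y)
      = P.toLinearMap (P.root i) (g.coweightMap _) at h2
    rw [h2, hcw]
  · rw [hw]
    apply z.injective
    have h1 := RootPairing.Hom.coroot_coweightMap_apply (f := g.toHom) (i := g.indexEquiv i)
    rw [Equiv.symm_apply_apply] at h1
    exact (hcw _).trans h1.symm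

@[simp]
theorem rootForm_tmul (i : ι) (r : ℝ) (y : Y) :
    rootForm P i (r ⊗ₜ[ℤ] y) = r * (P.root' i y : ℤ) := by
  simp [rootForm]

theorem coroot_smul_weylAct_ofIdx (i : ι) (y : Y) :
    weylAct P (RootPairing.weylGroup.ofIdx P i) y = y - P.root' i y • P.coroot i := by
  have : weylAct P (RootPairing.weylGroup.ofIdx P i) = (P.coreflection i)⁻¹ := by
    change (RootPairing.Equiv.coweightEquiv P P (RootPairing.Equiv.reflection P i))⁻¹ = _
    rw [RootPairing.Equiv.reflection_coweightEquiv]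
  rw [this, P.coreflection_inv, P.coreflection_apply]

theorem weylAct_injective : Function.Injective (weylAct P) := by
  intro v w h
  have h' := inv_injective h
  exact Subtype.ext (RootPairing.Equiv.coweightHom_injective P (MulOpposite.unop_injective h'))

theorem affineReflection_smul (i : ι) (k : ℤ) (x : Apartment Y) :
    affineReflection P i k • x = x - (rootForm P i x - k) • ((1 : ℝ) ⊗ₜ[ℤ] P.coroot i) := by
  rw [smul_eq]
  change (weylAct P (RootPairing.weylGroup.ofIdx P i)).toLinearMap.baseChange ℝ x
    + (1 : ℝ) ⊗ₜ[ℤ] (k • P.coroot i) = _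
  have h : (weylAct P (RootPairing.weylGroup.ofIdx P i)).toLinearMap.baseChange ℝ x
      = x - rootForm P i x • ((1 : ℝ) ⊗ₜ[ℤ] P.coroot i) := by
    induction x using TensorProduct.induction_on with
    | zero => simp
    | tmul r y =>
      rw [LinearMap.baseChange_tmul, LinearEquiv.coe_coe, coroot_smul_weylAct_ofIdx, tmul_sub,
        rootForm_tmul, ← smul_tmul, smul_tmul']
      congr 2
      rw [smul_eq_mul, mul_one, zsmul_eq_mul, mul_comm]
    | add x y hx hy => rw [map_add, hx, hy, map_add]; module
  rw [h, sub_smul, tmul_smul, Int.cast_smul_eq_zsmul]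
  abel

/-- The perfect pairing of `Q` makes Y torsion-free, hence flat over ℤ, so tensoring ℤ ⊂ ℝ with Y
stays injective. -/
theorem tmul_one_injective (Q : RootDatum ι X Y) :
    Function.Injective fun y : Y ↦ (1 : ℝ) ⊗ₜ[ℤ] y := by
  have : IsReflexive ℤ Y := .of_isPerfPair Q.flip.toLinearMap
  have : IsAddTorsionFree Y := .of_isTorsionFree ℤ Y
  have h := Module.Flat.rTensor_preserves_injective_linearMap (M := Y) (Algebra.linearMap ℤ ℝ)
    (by simpa using! Int.cast_injective)
  intro y z hyz
  have : (Algebra.linearMap ℤ ℝ).rTensor Y ((1 : ℤ) ⊗ₜ y)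
      = (Algebra.linearMap ℤ ℝ).rTensor Y (1 ⊗ₜ z) := by
    simpa using hyz
  simpa using congrArg (TensorProduct.lid ℤ Y) (h this)

/-- The value at 0 determines the translation part, and the values on lattice points then determine
the linear part. Group identities can therefore be checked on points. -/
theorem smul_injective {u v : ExtAffineWeyl P} (h : ∀ x : Apartment Y, u • x = v • x) : u = v := by
  have h0 := h 0
  simp only [smul_eq, map_zero, zero_add] at h0
  have ht : u.trans = v.trans := tmul_one_injective P h0
  have hl : weylAct P u.lin = weylAct P v.lin := by
    ext y
    have h1 := h (1 ⊗ₜ y)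
    rw [smul_eq, smul_eq, ht, add_left_inj] at h1
    exact tmul_one_injective P h1
  exact SemidirectProduct.ext (congrArg Multiplicative.ofAdd ht) (weylAct_injective P hl)

theorem rootForm_coroot (i j : ι) : rootForm P i ((1 : ℝ) ⊗ₜ[ℤ] P.coroot j) = P.pairing i j := by
  rw [rootForm_tmul, one_mul]; rfl

theorem rootForm_coroot_self (i : ι) : rootForm P i ((1 : ℝ) ⊗ₜ[ℤ] P.coroot i) = 2 := by
  rw [rootForm_coroot, RootPairing.pairing_same]; norm_num

theorem rootForm_affineReflection_smul (i j : ι) (k : ℤ) (x : Apartment Y) :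
    rootForm P j (affineReflection P i k • x)
      = rootForm P j x - (rootForm P i x - k) * P.pairing j i := by
  rw [affineReflection_smul, map_sub, map_smul, rootForm_coroot, smul_eq_mul]

theorem rootForm_affineReflection_smul_self (i : ι) (k : ℤ) (x : Apartment Y) :
    rootForm P i (affineReflection P i k • x) - k = -(rootForm P i x - k) := by
  rw [rootForm_affineReflection_smul, RootPairing.pairing_same]; push_cast; ring

@[simp]
theorem affineReflection_mul_self (i : ι) (k : ℤ) :
    affineReflection P i k * affineReflection P i k = 1 := by
  refine smul_injective P fun x ↦ ?_
  rw [mul_smul, one_smul, affineReflection_smul, affineReflection_smul P i k x, map_sub, map_smul,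
    rootForm_coroot_self, smul_eq_mul]
  module

@[simp]
theorem affineReflection_inv (i : ι) (k : ℤ) :
    (affineReflection P i k)⁻¹ = affineReflection P i k :=
  inv_eq_of_mul_eq_one_left (affineReflection_mul_self P i k)

@[simp]
theorem affineReflection_mul_cancel_left (i : ι) (k : ℤ) (u : ExtAffineWeyl P) :
    affineReflection P i k * (affineReflection P i k * u) = u := by
  rw [← mul_assoc, affineReflection_mul_self, one_mul]

theorem affineReflection_smul_of_mem {i : ι} {k : ℤ} {x : Apartment Y} (h : rootForm P i x = k) :
    affineReflection P i k • x = x := by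
  rw [affineReflection_smul, h, sub_self, zero_smul, sub_zero]

/-- The extended affine Weyl group permutes the affine roots, and conjugates the reflections
accordingly. -/
theorem exists_affine_root (u : ExtAffineWeyl P) (i : ι) (k : ℤ) :
    ∃ (j : ι) (l : ℤ), (∀ x : Apartment Y, rootForm P j (u • x) - l = rootForm P i x - k) ∧
      affineReflection P j l = u * affineReflection P i k * u⁻¹ := by
  obtain ⟨σ, h1, h2⟩ := exists_perm_weylAct P u.lin
  have h3 : ∀ x : Apartment Y,
      rootForm P (σ i) ((weylAct P u.lin).toLinearMap.baseChange ℝ x) = rootForm P i x := fun x ↦ by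
    induction x using TensorProduct.induction_on with
    | zero => simp
    | tmul r y =>
      rw [LinearMap.baseChange_tmul, rootForm_tmul, rootForm_tmul, LinearEquiv.coe_coe, h1]
    | add x y hx hy => rw [map_add, map_add, hx, hy, map_add]
  have h4 : ∀ x : Apartment Y, rootForm P (σ i) (u • x) - ((k + P.root' (σ i) u.trans : ℤ) : ℝ)
      = rootForm P i x - k := fun x ↦ by
    rw [smul_eq, map_add, h3, rootForm_tmul]; push_cast; ring
  refine ⟨σ i, k + P.root' (σ i) u.trans, h4, smul_injective P fun x ↦ ?_⟩
  obtain ⟨x, rfl⟩ : ∃ z, x = u • z := ⟨u⁻¹ • x, by rw [smul_inv_smul]⟩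
  rw [mul_smul, inv_smul_smul, mul_smul, affineReflection_smul, h4, affineReflection_smul, smul_eq,
    smul_eq, map_sub, map_smul, LinearMap.baseChange_tmul, LinearEquiv.coe_coe, h2]
  abel

theorem affineReflection_mem (i : ι) (k : ℤ) : affineReflection P i k ∈ affineWeyl P :=
  Subgroup.subset_closure ⟨i, k, rfl⟩

instance affineWeyl_normal : (affineWeyl P).Normal := by
  refine ⟨fun n hn g ↦ ?_⟩
  induction hn using Subgroup.closure_induction with
  | mem x hx =>
    obtain ⟨i, k, rfl⟩ := hx
    obtain ⟨j, l, -, h⟩ := exists_affine_root P g i k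
    rw [← h]
    exact affineReflection_mem P j l
  | one => simp
  | mul x y _ _ hx hy => rw [← conj_mul]; exact mul_mem hx hy
  | inv x _ hx => rw [← conj_inv]; exact inv_mem hx

/-- Points on the same side of the hyperplane `⟨α_i, p⟩ = k`, or both on it. -/
def SameSide (i : ι) (k : ℤ) (p q : Apartment Y) : Prop :=
  SignType.sign (rootForm P i p - k) = SignType.sign (rootForm P i q - k)

/-- Points that lie on no affine root hyperplane. -/
def IsGeneric (p : Apartment Y) : Prop := ∀ (i : ι) (k : ℤ), rootForm P i p ≠ k

/-- `x` lies in the closure of the facet of `p`. -/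
def Adheres (x p : Apartment Y) : Prop :=
  ∀ (i : ι) (k : ℤ), rootForm P i x ≠ k → SameSide P i k p x

variable {P}

namespace SameSide

variable {i : ι} {k : ℤ} {p q r : Apartment Y}

theorem symm (h : SameSide P i k p q) : SameSide P i k q p := Eq.symm h

theorem trans (h : SameSide P i k p q) (h' : SameSide P i k q r) : SameSide P i k p r :=
  Eq.trans h h'

theorem refl : SameSide P i k p p := rfl

end SameSide

theorem mem_facetOf {p q : Apartment Y} : q ∈ facetOf P p ↔ ∀ i k, SameSide P i k q p := Iff.rfl

theorem mem_facetOf_self (p : Apartment Y) : p ∈ facetOf P p := fun _ _ ↦ rfl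

theorem facetOf_eq {p q : Apartment Y} (h : q ∈ facetOf P p) : facetOf P q = facetOf P p := by
  ext r
  exact ⟨fun hr i k ↦ (hr i k).trans (h i k), fun hr i k ↦ (hr i k).trans (h i k).symm⟩

theorem SameSide.eq_iff {i : ι} {k : ℤ} {p q : Apartment Y} (h : SameSide P i k p q) :
    rootForm P i p = k ↔ rootForm P i q = k := by
  rw [SameSide] at h
  rw [← sub_eq_zero, ← sign_eq_zero_iff, h, sign_eq_zero_iff, sub_eq_zero]

theorem sameSide_smul_iff {u : ExtAffineWeyl P} {i j : ι} {k l : ℤ}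
    (h : ∀ x : Apartment Y, rootForm P j (u • x) - l = rootForm P i x - k) (p q : Apartment Y) :
    SameSide P j l (u • p) (u • q) ↔ SameSide P i k p q := by
  rw [SameSide, h, h]; rfl

theorem eq_iff_of_affine_root {u : ExtAffineWeyl P} {i j : ι} {k l : ℤ}
    (h : ∀ x : Apartment Y, rootForm P j (u • x) - l = rootForm P i x - k) (p : Apartment Y) :
    rootForm P j (u • p) = l ↔ rootForm P i p = k := by
  rw [← sub_eq_zero, h, sub_eq_zero]

/-- The inverse form of `exists_affine_root`. -/
theorem exists_affine_root_inv (u : ExtAffineWeyl P) (j : ι) (l : ℤ) :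
    ∃ (i : ι) (k : ℤ), (∀ x : Apartment Y, rootForm P j (u • x) - l = rootForm P i x - k) ∧
      affineReflection P j l = u * affineReflection P i k * u⁻¹ := by
  obtain ⟨i, k, h, h'⟩ := exists_affine_root P u⁻¹ j l
  refine ⟨i, k, fun x ↦ ?_, ?_⟩
  · rw [← h, inv_smul_smul]
  · rw [h']; group

theorem smul_mem_facetOf_iff (u : ExtAffineWeyl P) (p q : Apartment Y) :
    u • q ∈ facetOf P (u • p) ↔ q ∈ facetOf P p := by
  constructor
  · intro h i k
    obtain ⟨j, l, hj, -⟩ := exists_affine_root P u i k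
    exact (sameSide_smul_iff hj _ _).1 (h j l)
  · intro h j l
    obtain ⟨i, k, hj, -⟩ := exists_affine_root_inv u j l
    exact (sameSide_smul_iff hj _ _).2 (h i k)

theorem smul_facetOf (u : ExtAffineWeyl P) (p : Apartment Y) :
    u • facetOf P p = facetOf P (u • p) := by
  ext q
  rw [mem_smul_set_iff_inv_smul_mem, ← smul_mem_facetOf_iff u, smul_inv_smul]

theorem smul_facetOf_eq_iff {u : ExtAffineWeyl P} {p : Apartment Y} :
    u • facetOf P p = facetOf P p ↔ u • p ∈ facetOf P p := by
  rw [smul_facetOf]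
  exact ⟨fun h ↦ h ▸ mem_facetOf_self _, fun h ↦ facetOf_eq h⟩

theorem IsGeneric.smul {p : Apartment Y} (hp : IsGeneric P p) (u : ExtAffineWeyl P) :
    IsGeneric P (u • p) := by
  intro j l h
  obtain ⟨i, k, hj, -⟩ := exists_affine_root_inv u j l
  exact hp i k ((eq_iff_of_affine_root hj p).1 h)

theorem Adheres.smul {x p : Apartment Y} (h : Adheres P x p) (u : ExtAffineWeyl P) :
    Adheres P (u • x) (u • p) := by
  intro j l hx
  obtain ⟨i, k, hj, -⟩ := exists_affine_root_inv u j l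
  rw [Ne, eq_iff_of_affine_root hj] at hx
  exact (sameSide_smul_iff hj _ _).2 (h i k hx)

theorem Adheres.of_mem_facetOf {x y p : Apartment Y} (h : Adheres P x p) (hy : y ∈ facetOf P x) :
    Adheres P y p := fun i k hk ↦
  (h i k (by rwa [Ne, ← (mem_facetOf.1 hy i k).eq_iff])).trans (hy i k).symm

theorem Adheres.of_mem_facetOf_right {x p q : Apartment Y} (h : Adheres P x p)
    (hq : q ∈ facetOf P p) : Adheres P x q := fun i k hk ↦ (hq i k).trans (h i k hk)

theorem isAlcove_facetOf_iff {p : Apartment Y} : IsAlcove P (facetOf P p) ↔ IsGeneric P p := by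
  constructor
  · rintro ⟨-, h⟩ i k hik
    exact h i k fun q hq ↦ (mem_facetOf.1 hq i k).eq_iff.2 hik
  · intro h
    exact ⟨⟨p, rfl⟩, fun i k hik ↦ h i k (hik (mem_facetOf_self p))⟩

theorem sameSide_affineReflection_iff {i : ι} {k : ℤ} {p q : Apartment Y}
    (hp : rootForm P i p ≠ k) (hq : rootForm P i q ≠ k) :
    SameSide P i k p (affineReflection P i k • q) ↔ ¬ SameSide P i k p q := by
  rw [SameSide, SameSide, rootForm_affineReflection_smul_self, Left.sign_neg]
  rw [← sub_ne_zero, ← sign_ne_zero] at hp hq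
  revert hp hq
  generalize SignType.sign (rootForm P i p - k) = a
  generalize SignType.sign (rootForm P i q - k) = b
  revert a b
  decide

end Apartment

/-! ### Local finiteness, walls, and generic segments -/

section Geometry

variable {ι X Y : Type*} [AddCommGroup X] [AddCommGroup Y] {P : RootDatum ι X Y}

theorem sameSide_iff_mul_pos {i : ι} {k : ℤ} {p q : Apartment Y} (hp : rootForm P i p ≠ k)
    (hq : rootForm P i q ≠ k) :
    SameSide P i k p q ↔ 0 < (rootForm P i p - k) * (rootForm P i q - k) := by
  rw [SameSide]
  rw [← sub_ne_zero] at hp hq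
  rcases hp.lt_or_gt with h | h <;> rcases hq.lt_or_gt with h' | h' <;>
    simp [sign_neg, sign_pos, h, h', mul_pos_iff, h.not_gt, h'.not_gt]

/-- Moving a point slightly does not take it across a hyperplane on which it does not lie. -/
theorem eventually_sameSide [Finite ι] (x v : Apartment Y) :
    ∀ᶠ s : ℝ in 𝓝 0, ∀ (i : ι) (k : ℤ), rootForm P i x ≠ k → SameSide P i k (x + s • v) x := by
  rw [eventually_all]
  intro i
  have hc : Tendsto (fun s : ℝ ↦ rootForm P i (x + s • v)) (𝓝 0) (𝓝 (rootForm P i x)) := by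
    have : (fun s : ℝ ↦ rootForm P i (x + s • v))
        = fun s ↦ rootForm P i x + s * rootForm P i v := by
      ext s; rw [map_add, map_smul, smul_eq_mul]
    rw [this]
    have h : Continuous fun s : ℝ ↦ rootForm P i x + s * rootForm P i v := by fun_prop
    simpa using h.tendsto 0
  -- The open interval from ⌈α(x)⌉ - 1 to ⌊α(x)⌋ + 1 contains α(x) and no integer other than
  -- possibly α(x), so one neighbourhood serves all k at once.
  have h1 : ((⌈rootForm P i x⌉ - 1 : ℤ) : ℝ) < rootForm P i x := by
    push_cast; linarith [Int.ceil_lt_add_one (rootForm P i x)]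
  have h2 : rootForm P i x < ((⌊rootForm P i x⌋ + 1 : ℤ) : ℝ) := by
    push_cast; exact Int.lt_floor_add_one _
  filter_upwards [hc.eventually (lt_mem_nhds h1), hc.eventually (gt_mem_nhds h2)]
    with s hs1 hs2 k hk
  rw [SameSide]
  rcases hk.lt_or_gt with h | h
  · have : ((⌊rootForm P i x⌋ + 1 : ℤ) : ℝ) ≤ k := by
      exact_mod_cast Int.add_one_le_of_lt (Int.floor_lt.2 h)
    rw [sign_neg (by linarith), sign_neg (by linarith)]
  · have : (k : ℝ) ≤ ((⌈rootForm P i x⌉ - 1 : ℤ) : ℝ) := by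
      exact_mod_cast Int.le_sub_one_of_lt (Int.lt_ceil.2 h)
    rw [sign_pos (by linarith), sign_pos (by linarith)]

variable (P) in
/-- The affine roots that separate two points. -/
def separating (p q : Apartment Y) : Set (ι × ℤ) := {φ | ¬ SameSide P φ.1 φ.2 p q}

/-- For each of the finitely many roots, only integers between its values at the two points can
separate them. -/
theorem separating_finite [Finite ι] (p q : Apartment Y) : (separating P p q).Finite := by
  refine (finite_iUnion fun i : ι ↦ (finite_singleton i).prod
    (finite_Icc ⌊min (rootForm P i p) (rootForm P i q)⌋
      ⌈max (rootForm P i p) (rootForm P i q)⌉)).subset fun φ hφ ↦ mem_iUnion.2 ⟨φ.1, rfl, ?_⟩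
  rw [mem_Icc]
  by_contra hcon
  refine hφ ?_
  rw [not_and_or, not_le, not_le] at hcon
  rw [SameSide]
  rcases hcon with h | h
  · have h : (φ.2 : ℝ) < min (rootForm P φ.1 p) (rootForm P φ.1 q) := by
      have : ((φ.2 + 1 : ℤ) : ℝ) ≤ min (rootForm P φ.1 p) (rootForm P φ.1 q) := Int.le_floor.1 h
      push_cast at this; linarith
    rw [lt_min_iff] at h
    rw [sign_pos (sub_pos.2 h.1), sign_pos (sub_pos.2 h.2)]
  · have h : max (rootForm P φ.1 p) (rootForm P φ.1 q) < φ.2 := by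
      have : ((φ.2 - 1 : ℤ) : ℝ) ≥ max (rootForm P φ.1 p) (rootForm P φ.1 q) :=
        Int.ceil_le.1 (by omega)
      push_cast at this; linarith
    rw [max_lt_iff] at h
    rw [sign_neg (sub_neg.2 h.1), sign_neg (sub_neg.2 h.2)]

/-- Open half-spaces are open, so strict inequalities at `x` hold at nearby points of the facet of
`p`. Conversely, points of the open segment from a point of the facet of `x` to `p` have the signs
of `p`. This removes topology from the rest of the argument. -/
theorem isSubfacet_iff {x p : Apartment Y} :
    IsSubfacet (facetOf P x) (facetOf P p) ↔ Adheres P x p := by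
  let _ : TopologicalSpace (Apartment Y) := moduleTopology ℝ (Apartment Y)
  have : IsModuleTopology ℝ (Apartment Y) := ⟨rfl⟩
  have : ContinuousAdd (Apartment Y) := IsModuleTopology.toContinuousAdd ℝ _
  have : ContinuousSMul ℝ (Apartment Y) := IsModuleTopology.toContinuousSMul ℝ _
  constructor
  · intro h i k hk
    have hc : Continuous (rootForm P i) := IsModuleTopology.continuous_of_linearMap _
    have hx : x ∈ closure (facetOf P p) := h (mem_facetOf_self x)
    rw [mem_closure_iff] at hx
    rcases hk.lt_or_gt with h | h
    · obtain ⟨z, hz, hz'⟩ := hx {z | rootForm P i z < k} (isOpen_lt hc continuous_const) h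
      refine (mem_facetOf.1 hz' i k).symm.trans ?_
      rw [SameSide, sign_neg (sub_neg.2 h), sign_neg (sub_neg.2 hz)]
    · obtain ⟨z, hz, hz'⟩ := hx {z | k < rootForm P i z} (isOpen_lt continuous_const hc) h
      refine (mem_facetOf.1 hz' i k).symm.trans ?_
      rw [SameSide, sign_pos (sub_pos.2 h), sign_pos (sub_pos.2 hz)]
  · intro h y hy
    have hyp := h.of_mem_facetOf hy
    have hc : Tendsto (fun s : ℝ ↦ (1 - s) • y + s • p) (𝓝[>] 0) (𝓝 y) := by
      have : Continuous fun s : ℝ ↦ (1 - s) • y + s • p := by fun_prop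
      simpa using (this.tendsto 0).mono_left nhdsWithin_le_nhds
    refine mem_closure_of_tendsto hc ?_
    filter_upwards [Ioo_mem_nhdsGT one_pos] with s hs
    rw [mem_facetOf]
    intro i k
    have hv : rootForm P i ((1 - s) • y + s • p) - k
        = (1 - s) * (rootForm P i y - k) + s * (rootForm P i p - k) := by
      rw [map_add, map_smul, map_smul, smul_eq_mul, smul_eq_mul]; ring
    by_cases hk : rootForm P i y = k
    · rw [SameSide, hv, hk, sub_self, mul_zero, zero_add, sign_mul, sign_pos hs.1, one_mul]
    · have h1 := hyp i k hk
      rw [SameSide] at h1 ⊢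
      rw [hv]
      have hs1 : 0 < 1 - s := sub_pos.2 hs.2
      rcases (sub_ne_zero.2 hk).lt_or_gt with h2 | h2
      · rw [sign_neg h2, sign_eq_neg_one_iff] at h1
        rw [sign_neg h1, sign_neg]
        nlinarith [mul_neg_of_pos_of_neg hs1 h2, mul_neg_of_pos_of_neg hs.1 h1]
      · rw [sign_pos h2, sign_eq_one_iff] at h1
        rw [sign_pos h1, sign_pos]
        nlinarith [mul_pos hs1 h2, mul_pos hs.1 h1]

/-- In a reduced root datum, affine roots with the same hyperplane agree up to sign. -/
theorem affine_root_eq_or_eq_neg [P.IsReduced] {i j : ι} {k l : ℤ}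
    (h : hyperplane P i k ⊆ hyperplane P j l) :
    ((∀ x, rootForm P j x - l = rootForm P i x - k) ∧ P.coroot j = P.coroot i ∧ l = k) ∨
    ((∀ x, rootForm P j x - l = -(rootForm P i x - k)) ∧ P.coroot j = -P.coroot i ∧ l = -k) := by
  have : IsReflexive ℤ X := .of_isPerfPair P.toLinearMap
  have : IsReflexive ℤ Y := .of_isPerfPair P.flip.toLinearMap
  have : IsAddTorsionFree X := .of_isTorsionFree ℤ X
  set x₀ : Apartment Y := ((k : ℝ) / 2) • ((1 : ℝ) ⊗ₜ[ℤ] P.coroot i) with hx₀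
  have h0 : rootForm P i x₀ = k := by
    rw [hx₀, map_smul, rootForm_coroot_self, smul_eq_mul]; ring
  have h0' : rootForm P j x₀ = l := h h0
  -- The vector 2y - ⟨α_i, y⟩ α_i^∨ is killed by α_i. Moving `x₀` along it stays in the first
  -- hyperplane, hence in the second, so α_j kills it too. The two roots are then proportional, and
  -- reducedness applies.
  have h1 : ∀ y : Y, 2 * P.root' j y = P.root' i y * P.pairing j i := fun y ↦ by
    have h2 : rootForm P i (x₀ + (1 : ℝ) ⊗ₜ[ℤ] (2 • y - P.root' i y • P.coroot i)) = k := by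
      rw [map_add, h0, rootForm_tmul, map_sub, map_nsmul, map_smul, P.root'_coroot_eq_pairing,
        P.pairing_same]
      push_cast [nsmul_eq_mul, smul_eq_mul]
      ring
    have h3 : rootForm P j (x₀ + (1 : ℝ) ⊗ₜ[ℤ] (2 • y - P.root' i y • P.coroot i)) = l := h h2
    rw [map_add, h0', rootForm_tmul, map_sub, map_nsmul, map_smul, P.root'_coroot_eq_pairing] at h3
    have h4 : ((2 • P.root' j y - P.root' i y • P.pairing j i : ℤ) : ℝ) = 0 := by linarith
    have h5 := Int.cast_eq_zero.1 h4
    simp only [nsmul_eq_mul, smul_eq_mul, Nat.cast_ofNat] at h5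
    linarith
  have h6 : (2 : ℤ) • P.root j = P.pairing j i • P.root i := apply_root_injective P fun y ↦ by
    rw [map_smul, map_smul, LinearMap.smul_apply, LinearMap.smul_apply, smul_eq_mul, smul_eq_mul,
      mul_comm (P.pairing j i)]
    exact h1 y
  have h7 : ¬ LinearIndependent ℤ ![P.root i, P.root j] := by
    rw [LinearIndependent.pair_iff]
    intro h
    have := (h (P.pairing j i) (-2) (by rw [neg_smul, h6, add_neg_cancel])).2
    norm_num at this
  rcases RootPairing.IsReduced.eq_or_eq_neg i j h7 with h8 | h8
  · have hij : i = j := P.root.injective h8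
    subst hij
    have hkl : l = k := by exact_mod_cast h0'.symm.trans h0
    subst hkl
    exact Or.inl ⟨fun _ ↦ rfl, rfl, rfl⟩
  · have hf : ∀ x, rootForm P j x = - rootForm P i x := fun x ↦ by
      induction x using TensorProduct.induction_on with
      | zero => simp
      | tmul r y =>
        have : P.root' i y = - P.root' j y := by
          change P.toLinearMap (P.root i) y = - P.toLinearMap (P.root j) y
          rw [h8, map_neg, LinearMap.neg_apply]
        rw [rootForm_tmul, rootForm_tmul, this]; push_cast; ring
      | add x y hx hy => rw [map_add, map_add, hx, hy]; ring
    have hkl : l = -k := by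
      have : (l : ℝ) = ((-k : ℤ) : ℝ) := by rw [← h0', hf, h0]; push_cast; rfl
      exact_mod_cast this
    refine Or.inr ⟨fun x ↦ ?_, ?_, hkl⟩
    · rw [hf, hkl]; push_cast; ring
    · rw [P.coroot_eq_neg_iff.2 (P.root_eq_neg_iff.1 h8), neg_neg]

theorem affineReflection_eq_of_hyperplane_subset [P.IsReduced] {i j : ι} {k l : ℤ}
    (h : hyperplane P i k ⊆ hyperplane P j l) :
    affineReflection P j l = affineReflection P i k := by
  refine smul_injective P fun x ↦ ?_
  rw [affineReflection_smul, affineReflection_smul]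
  rcases affine_root_eq_or_eq_neg h with ⟨h1, h2, -⟩ | ⟨h1, h2, -⟩
  · rw [h1, h2]
  · rw [h1, h2, tmul_neg, smul_neg, neg_smul, neg_neg]

theorem sameSide_iff_of_hyperplane_subset [P.IsReduced] {i j : ι} {k l : ℤ}
    (h : hyperplane P i k ⊆ hyperplane P j l) (p q : Apartment Y) :
    SameSide P j l p q ↔ SameSide P i k p q := by
  rw [SameSide, SameSide]
  rcases affine_root_eq_or_eq_neg h with ⟨h1, -, -⟩ | ⟨h1, -, -⟩
  · rw [h1, h1]
  · rw [h1, h1, Left.sign_neg, Left.sign_neg, neg_inj]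

/-- `x` lies on the hyperplane `⟨α_i, x⟩ = k` and on no other affine root hyperplane. -/
def LiesOnlyOn (P : RootDatum ι X Y) (i : ι) (k : ℤ) (x : Apartment Y) : Prop :=
  rootForm P i x = k ∧ ∀ (j : ι) (l : ℤ), rootForm P j x = l → hyperplane P j l = hyperplane P i k

theorem isWall_facetOf_iff {p : Apartment Y} {i : ι} {k : ℤ} :
    IsWall P (facetOf P p) i k ↔ ∃ x, LiesOnlyOn P i k x ∧ Adheres P x p := by
  constructor
  · rintro ⟨f, ⟨x, rfl⟩, hf, hx, h⟩
    exact ⟨x, ⟨hx (mem_facetOf_self x), fun j l hj ↦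
      h j l fun y hy ↦ (mem_facetOf.1 hy j l).eq_iff.2 hj⟩, isSubfacet_iff.1 hf⟩
  · rintro ⟨x, ⟨hx, h⟩, hp⟩
    exact ⟨facetOf P x, ⟨x, rfl⟩, isSubfacet_iff.2 hp, fun y hy ↦
      (mem_facetOf.1 hy i k).eq_iff.2 hx, fun j l hj ↦ h j l (hj (mem_facetOf_self x))⟩

theorem hyperplane_eq_of_affine_root {u : ExtAffineWeyl P} {i j : ι} {k l : ℤ}
    (h : ∀ x : Apartment Y, rootForm P j (u • x) - l = rootForm P i x - k) :
    hyperplane P j l = u • hyperplane P i k := by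
  ext x
  rw [mem_smul_set_iff_inv_smul_mem]
  have := eq_iff_of_affine_root h (u⁻¹ • x)
  rwa [smul_inv_smul] at this

theorem LiesOnlyOn.smul {u : ExtAffineWeyl P} {i j : ι} {k l : ℤ} {x : Apartment Y}
    (hx : LiesOnlyOn P i k x)
    (h : ∀ x : Apartment Y, rootForm P j (u • x) - l = rootForm P i x - k) :
    LiesOnlyOn P j l (u • x) := by
  refine ⟨(eq_iff_of_affine_root h x).2 hx.1, fun j' l' hj' ↦ ?_⟩
  obtain ⟨i', k', h', -⟩ := exists_affine_root_inv u j' l'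
  rw [hyperplane_eq_of_affine_root h, hyperplane_eq_of_affine_root h',
    hx.2 i' k' ((eq_iff_of_affine_root h' x).1 hj')]

theorem IsWall.smul {u : ExtAffineWeyl P} {i j : ι} {k l : ℤ} {p : Apartment Y}
    (hw : IsWall P (facetOf P p) i k)
    (h : ∀ x : Apartment Y, rootForm P j (u • x) - l = rootForm P i x - k) :
    IsWall P (facetOf P (u • p)) j l := by
  obtain ⟨x, hx, hxp⟩ := isWall_facetOf_iff.1 hw
  exact isWall_facetOf_iff.2 ⟨u • x, hx.smul h, hxp.smul u⟩

/-- Replacing `p` by a suitable point of the same alcove, the segment to `q` meets no intersection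
of two different hyperplanes. -/
theorem exists_generic_segment [Finite ι] {p q : Apartment Y} (hp : IsGeneric P p)
    (hq : IsGeneric P q) :
    ∃ p' ∈ facetOf P p, ∀ t ∈ Icc (0 : ℝ) 1, ∀ (i : ι) (k : ℤ),
      rootForm P i (p' + t • (q - p')) = k → LiesOnlyOn P i k (p' + t • (q - p')) := by
  have hfin : Finite (separating P p q) := (separating_finite p q).to_subtype
  -- With A = α - k and B = β - l, this is the linear part of B(q) A - A(q) B, which vanishes at q.
  -- If A and B both vanish at a point of the segment other than q, then γ kills p' - q. If γ = 0,
  -- then A and B are proportional and define the same hyperplane. So p' is chosen to avoid the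
  -- kernels of the finitely many nonzero γ.
  let γ : (ι × ℤ) × (ι × ℤ) → Dual ℝ (Apartment Y) := fun a ↦
    (rootForm P a.2.1 q - a.2.2) • rootForm P a.1.1
      - (rootForm P a.1.1 q - a.1.2) • rootForm P a.2.1
  let T := {a : separating P p q × separating P p q // γ (a.1, a.2) ≠ 0}
  obtain ⟨v, hv⟩ := Module.Dual.exists_forall_ne_zero_of_forall_exists
    (fun a : T ↦ γ (a.1.1, a.1.2)) fun a ↦ by
      by_contra! h
      exact a.2 (LinearMap.ext h)
  have h1 : ∀ᶠ s : ℝ in 𝓝[≠] 0, ∀ a : T, γ (a.1.1, a.1.2) (p + s • v - q) ≠ 0 := by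
    rw [eventually_all]
    intro a
    set g := γ (a.1.1, a.1.2) with hg
    have hval : ∀ s : ℝ, g (p + s • v - q) = g (p - q) + s * g v := fun s ↦ by
      rw [map_sub, map_add, map_smul, map_sub, smul_eq_mul]; ring
    simp only [hval]
    -- The value is affine in s with slope g v ≠ 0. If it vanishes at s = 0, every s ≠ 0 works;
    -- otherwise every small s does.
    by_cases h0 : g (p - q) = 0
    · filter_upwards [self_mem_nhdsWithin] with s hs
      rw [h0, zero_add]
      exact mul_ne_zero hs (hv a)
    · have hc : Continuous fun s : ℝ ↦ g (p - q) + s * g v := by fun_prop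
      have := hc.tendsto 0
      rw [zero_mul, add_zero] at this
      exact (this.eventually_ne h0).filter_mono nhdsWithin_le_nhds
  obtain ⟨s, hs1, hs2⟩ := (h1.and ((eventually_sameSide (P := P) p v).filter_mono
    nhdsWithin_le_nhds)).exists
  have hmem : p + s • v ∈ facetOf P p := fun i k ↦ hs2 i k (hp i k)
  refine ⟨p + s • v, hmem, ?_⟩
  generalize p + s • v = p' at hs1 hmem
  intro t ht
  have key : ∀ (i : ι) (k : ℤ), rootForm P i (p' + t • (q - p')) = k →
      (1 - t) * (rootForm P i p' - k) + t * (rootForm P i q - k) = 0 ∧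
        (i, k) ∈ separating P p q := fun i k hik ↦ by
    rw [map_add, map_smul, map_sub, smul_eq_mul] at hik
    have h2 : (1 - t) * (rootForm P i p' - k) + t * (rootForm P i q - k) = 0 := by linarith
    refine ⟨h2, fun hss ↦ ?_⟩
    have h3 : SameSide P i k p' q := (mem_facetOf.1 hmem i k).trans hss
    have hp' : rootForm P i p' ≠ k := by
      rw [Ne, (mem_facetOf.1 hmem i k).eq_iff]; exact hp i k
    rw [sameSide_iff_mul_pos hp' (hq i k)] at h3
    rcases mul_pos_iff.1 h3 with h | h
    · nlinarith [ht.1, ht.2, mul_nonneg (sub_nonneg.2 ht.2) h.1.le, mul_nonneg ht.1 h.2.le]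
    · nlinarith [ht.1, ht.2, mul_nonneg (sub_nonneg.2 ht.2) (neg_nonneg.2 h.1.le),
        mul_nonneg ht.1 (neg_nonneg.2 h.2.le)]
  intro i k hik
  refine ⟨hik, fun j l hjl ↦ ?_⟩
  obtain ⟨hA, hA'⟩ := key i k hik
  obtain ⟨hB, hB'⟩ := key j l hjl
  have hAq := sub_ne_zero.2 (hq i k)
  have hBq := sub_ne_zero.2 (hq j l)
  have ht1 : 1 - t ≠ 0 := fun h ↦ by
    rw [h, zero_mul, zero_add] at hA
    rcases mul_eq_zero.1 hA with h' | h'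
    · linarith
    · exact hAq h'
  have hdet : (rootForm P j q - l) * (rootForm P i p' - k)
      - (rootForm P i q - k) * (rootForm P j p' - l) = 0 := by
    apply mul_left_cancel₀ ht1
    linear_combination (rootForm P j q - l) * hA - (rootForm P i q - k) * hB
  have hγ : γ ((i, k), (j, l)) = 0 := by
    by_contra hne
    refine hs1 ⟨(⟨_, hA'⟩, ⟨_, hB'⟩), hne⟩ ?_
    simp only [γ, LinearMap.sub_apply, LinearMap.smul_apply, smul_eq_mul, map_sub]
    linear_combination hdet
  ext x
  have hx : (rootForm P j q - l) * (rootForm P i x - k)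
      = (rootForm P i q - k) * (rootForm P j x - l) := by
    have h2 := LinearMap.congr_fun hγ (x - q)
    simp only [γ, LinearMap.sub_apply, LinearMap.smul_apply, smul_eq_mul, map_sub,
      LinearMap.zero_apply] at h2
    linear_combination h2
  change rootForm P j x = l ↔ rootForm P i x = k
  rw [← sub_eq_zero, ← sub_eq_zero (b := (k : ℝ))]
  constructor
  · intro h
    rw [h, mul_zero] at hx
    exact (mul_eq_zero.1 hx).resolve_left hBq
  · intro h
    rw [h, mul_zero] at hx
    exact (mul_eq_zero.1 hx.symm).resolve_left hAq

/-- If `q` does not lie in the alcove of `p`, then a wall of this alcove separates them. -/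
theorem exists_wall_separating [Finite ι] {p q : Apartment Y} (hp : IsGeneric P p)
    (hq : IsGeneric P q) (h : q ∉ facetOf P p) :
    ∃ i k, IsWall P (facetOf P p) i k ∧ ¬ SameSide P i k p q := by
  obtain ⟨p', hp', hseg⟩ := exists_generic_segment hp hq
  have hpg : IsGeneric P p' := fun i k ↦ by
    rw [Ne, (mem_facetOf.1 hp' i k).eq_iff]; exact hp i k
  have hS : ∀ i k, SameSide P i k p' q ↔ SameSide P i k p q := fun i k ↦
    ⟨(mem_facetOf.1 hp' i k).symm.trans, (mem_facetOf.1 hp' i k).trans⟩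
  -- The parameter at which the segment from p' to q crosses the hyperplane φ. The first crossing is
  -- a point where the segment leaves the alcove, and genericity puts it on a single hyperplane.
  let τ : ι × ℤ → ℝ := fun φ ↦
    (rootForm P φ.1 p' - φ.2) / ((rootForm P φ.1 p' - φ.2) - (rootForm P φ.1 q - φ.2))
  have hne : (separating P p' q).Nonempty := by
    rw [mem_facetOf] at h
    push Not at h
    obtain ⟨i, k, hik⟩ := h
    exact ⟨(i, k), fun h' ↦ hik (((hS i k).1 h').symm)⟩
  obtain ⟨⟨i, k⟩, hik, hmin⟩ := exists_min_image _ τ (separating_finite p' q) hne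
  have hsep : ∀ φ ∈ separating P p' q, (rootForm P φ.1 p' - φ.2) * (rootForm P φ.1 q - φ.2) < 0 :=
    fun φ hφ ↦ by
      have h1 := (sameSide_iff_mul_pos (hpg φ.1 φ.2) (hq φ.1 φ.2)).not.1 hφ
      exact lt_of_le_of_ne (not_lt.1 h1)
        (mul_ne_zero (sub_ne_zero.2 (hpg _ _)) (sub_ne_zero.2 (hq _ _)))
  set t := τ (i, k) with ht
  have hval : ∀ (j : ι) (l : ℤ), rootForm P j (p' + t • (q - p')) - l
      = (rootForm P j p' - l) - t * ((rootForm P j p' - l) - (rootForm P j q - l)) := fun j l ↦ by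
    rw [map_add, map_smul, map_sub, smul_eq_mul]; ring
  have hτ : 0 < t ∧ t < 1 := by
    have := hsep _ hik
    rw [ht]
    simp only [τ]
    rcases mul_neg_iff.1 this with h | h
    · exact ⟨div_pos h.1 (by linarith), (div_lt_one (by linarith)).2 (by linarith)⟩
    · exact ⟨div_pos_of_neg_of_neg h.1 (by linarith),
        (div_lt_one_of_neg (by linarith)).2 (by linarith)⟩
  have hx0 : rootForm P i (p' + t • (q - p')) = k := by
    have h1 := hsep _ hik
    have h2 : (rootForm P i p' - k) - (rootForm P i q - k) ≠ 0 := by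
      rcases mul_neg_iff.1 h1 with h | h
      · exact (by linarith : 0 < (rootForm P i p' - k) - (rootForm P i q - k)).ne'
      · exact (by linarith : (rootForm P i p' - k) - (rootForm P i q - k) < 0).ne
    rw [← sub_eq_zero, hval, ht]
    simp only [τ]
    rw [div_mul_cancel₀ _ h2, sub_self]
  refine ⟨i, k, isWall_facetOf_iff.2 ⟨_, hseg t ⟨hτ.1.le, hτ.2.le⟩ i k hx0, ?_⟩, (hS i k).not.1 hik⟩
  refine Adheres.of_mem_facetOf_right (p := p') (fun j l hjl ↦ ?_) fun i k ↦
    (mem_facetOf.1 hp' i k).symm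
  rw [sameSide_iff_mul_pos (hpg j l) hjl, hval]
  -- A hyperplane strictly separating p' from the crossing point would also separate p' from q and
  -- would be crossed before time t, against minimality.
  by_contra hcon
  have hlt : (rootForm P j p' - l) *
      ((rootForm P j p' - l) - t * ((rootForm P j p' - l) - (rootForm P j q - l))) < 0 := by
    refine lt_of_le_of_ne (not_lt.1 hcon) (mul_ne_zero (sub_ne_zero.2 (hpg _ _)) ?_)
    rw [← hval]; exact sub_ne_zero.2 hjl
  have hmem : (j, l) ∈ separating P p' q := fun hss ↦ by
    rw [sameSide_iff_mul_pos (hpg j l) (hq j l)] at hss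
    nlinarith [mul_pos hτ.1 hss,
      mul_nonneg (sub_nonneg.2 hτ.2.le) (sq_nonneg (rootForm P j p' - l))]
  have h2 := hmin _ hmem
  have h3 := hsep _ hmem
  have h4 : t ≤ (rootForm P j p' - l) / ((rootForm P j p' - l) - (rootForm P j q - l)) := h2
  rcases mul_neg_iff.1 h3 with ⟨h5, h6⟩ | ⟨h5, h6⟩
  · have h5 : 0 < rootForm P j p' - l := h5
    have h6 : rootForm P j q - l < 0 := h6
    rw [le_div_iff₀ (by linarith)] at h4
    nlinarith
  · have h5 : rootForm P j p' - l < 0 := h5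
    have h6 : 0 < rootForm P j q - l := h6
    rw [le_div_iff_of_neg (by linarith)] at h4
    nlinarith

/-- A generic segment from near `p` to the mirror image of `p` crosses the hyperplane, and the
crossing point lies on no other one. -/
theorem exists_liesOnlyOn [Finite ι] {p : Apartment Y} (hp : IsGeneric P p) (i : ι) (k : ℤ) :
    ∃ x, LiesOnlyOn P i k x := by
  obtain ⟨p', hp', hseg⟩ := exists_generic_segment hp (hp.smul (affineReflection P i k))
  have hv : ∀ t : ℝ, rootForm P i (p' + t • (affineReflection P i k • p - p')) - k
      = (1 - t) * (rootForm P i p' - k) - t * (rootForm P i p - k) := fun t ↦ by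
    have := rootForm_affineReflection_smul_self P i k p
    rw [map_add, map_smul, map_sub, smul_eq_mul]
    linear_combination t * this
  set a := rootForm P i p' - k
  set b := rootForm P i p - k
  have hb : b ≠ 0 := sub_ne_zero.2 (hp i k)
  have hab : 0 < a * b := by
    have hp'' : rootForm P i p' ≠ k := by
      rw [Ne, (mem_facetOf.1 hp' i k).eq_iff]; exact hp i k
    exact (sameSide_iff_mul_pos hp'' (hp i k)).1 (hp' i k)
  -- Along the segment the affine root goes from a to -b, with a and b of the same sign, so it
  -- vanishes at time a / (a + b).
  have ht : a / (a + b) ∈ Icc (0 : ℝ) 1 ∧ a + b ≠ 0 := by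
    rcases mul_pos_iff.1 hab with h | h
    · exact ⟨⟨div_nonneg h.1.le (by linarith), (div_le_one (by linarith)).2 (by linarith)⟩,
        by linarith⟩
    · exact ⟨⟨div_nonneg_of_nonpos h.1.le (by linarith),
        (div_le_one_of_neg (by linarith)).2 (by linarith)⟩, by linarith⟩
  refine ⟨_, hseg _ ht.1 i k ?_⟩
  rw [← sub_eq_zero, hv]
  have := ht.2
  field_simp
  ring

/-- Every affine root hyperplane is a wall of some alcove. -/
theorem exists_isWall [Finite ι] {p : Apartment Y} (hp : IsGeneric P p) (i : ι) (k : ℤ) :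
    ∃ q, IsGeneric P q ∧ IsWall P (facetOf P q) i k := by
  obtain ⟨x, hx⟩ := exists_liesOnlyOn hp i k
  obtain ⟨s, hs, hs0⟩ := (((eventually_sameSide (P := P) x ((1 : ℝ) ⊗ₜ[ℤ] P.coroot i)).filter_mono
    nhdsWithin_le_nhds).and (self_mem_nhdsWithin : ∀ᶠ s : ℝ in 𝓝[≠] 0, s ∈ ({0}ᶜ : Set ℝ))).exists
  -- The coroot is transversal to the only hyperplane through x, and a small displacement meets no
  -- other one.
  refine ⟨x + s • ((1 : ℝ) ⊗ₜ[ℤ] P.coroot i), fun j l hjl ↦ ?_, isWall_facetOf_iff.2 ⟨x, hx, hs⟩⟩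
  by_cases hj : rootForm P j x = l
  · have h1 : x + s • ((1 : ℝ) ⊗ₜ[ℤ] P.coroot i) ∈ hyperplane P i k := hx.2 j l hj ▸ hjl
    have h2 : rootForm P i (x + s • ((1 : ℝ) ⊗ₜ[ℤ] P.coroot i)) = k := h1
    rw [map_add, hx.1, map_smul, rootForm_coroot_self, smul_eq_mul] at h2
    exact hs0 (by simpa using h2)
  · exact hj ((hs j l hj).eq_iff.1 hjl)

end Geometry

/-! ### Coxeter combinatorics: exchange, length and Bruhat order via separation -/

section Combinatorics

variable {ι X Y : Type*} [AddCommGroup X] [AddCommGroup Y] {P : RootDatum ι X Y}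

theorem Adheres.sameSide {x p q : Apartment Y} {i : ι} {k : ℤ} (hp : Adheres P x p)
    (hq : Adheres P x q) (h : rootForm P i x ≠ k) : SameSide P i k p q :=
  (hp i k h).trans (hq i k h).symm

/-- An alcove and its image under the reflection across a wall are separated by this wall only. -/
theorem IsWall.hyperplane_eq {p : Apartment Y} {i j : ι} {k l : ℤ}
    (hw : IsWall P (facetOf P p) i k) (h : ¬ SameSide P j l p (affineReflection P i k • p)) :
    hyperplane P j l = hyperplane P i k := by
  obtain ⟨x, hx, hxp⟩ := isWall_facetOf_iff.1 hw
  refine hx.2 j l ?_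
  by_contra hj
  have := hxp.smul (affineReflection P i k)
  rw [affineReflection_smul_of_mem P hx.1] at this
  exact h (hxp.sameSide this hj)

/-- Reflecting across a wall changes sides with respect to that wall only, so crossing a separating
wall removes it and adds nothing. This is the descent behind transitivity on alcoves. -/
theorem IsWall.separating_ssubset [P.IsReduced] {p q : Apartment Y} (hp : IsGeneric P p)
    (hq : IsGeneric P q) {i : ι} {k : ℤ} (hw : IsWall P (facetOf P p) i k)
    (h : ¬ SameSide P i k p q) :
    separating P (affineReflection P i k • p) q ⊂ separating P p q := by
  have h1 : SameSide P i k (affineReflection P i k • p) q :=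
    ((sameSide_affineReflection_iff (hq i k) (hp i k)).2 fun h' ↦ h h'.symm).symm
  rw [ssubset_iff_of_subset]
  · exact ⟨(i, k), h, fun h' ↦ h' h1⟩
  · intro φ hφ hss
    by_cases h2 : SameSide P φ.1 φ.2 p (affineReflection P i k • p)
    · exact hφ (h2.symm.trans hss)
    · have := (sameSide_iff_of_hyperplane_subset (hw.hyperplane_eq h2).ge
        (affineReflection P i k • p) q).2 h1
      exact hφ this

/-- Pulling a wall of the translated alcove back by `u` gives a wall of the base alcove. So crossing
a wall of u a amounts to multiplying `u` on the right by a simple reflection. -/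
theorem mem_simpleReflections_of_isWall {p : Apartment Y} {u : ExtAffineWeyl P} {j : ι} {l : ℤ}
    (h : IsWall P (facetOf P (u • p)) j l) :
    u⁻¹ * affineReflection P j l * u ∈ simpleReflections P (facetOf P p) := by
  obtain ⟨i, k, h1, h2⟩ := exists_affine_root P u⁻¹ j l
  refine ⟨i, k, ?_, by rw [h2, inv_inv]⟩
  have := h.smul h1
  rwa [inv_smul_smul] at this

variable {p : Apartment Y}

theorem exists_eq_affineReflection_of_mem_reflections {t : ExtAffineWeyl P}
    (ht : t ∈ reflections (simpleReflections P (facetOf P p))) :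
    ∃ i k, t = affineReflection P i k := by
  obtain ⟨g, -, _, ⟨i, k, -, rfl⟩, rfl⟩ := ht
  obtain ⟨j, l, -, h⟩ := exists_affine_root P g i k
  exact ⟨j, l, h.symm⟩

theorem wordLength_le {G : Type*} [Group G] {S : Set G} {l : List G} (h : ∀ s ∈ l, s ∈ S) :
    wordLength S l.prod ≤ l.length :=
  Nat.sInf_le ⟨l, rfl, h, rfl⟩

theorem mem_alcoveStab_iff {τ : ExtAffineWeyl P} :
    τ ∈ alcoveStab P (facetOf P p) ↔ τ • p ∈ facetOf P p := by
  rw [alcoveStab, MulAction.mem_stabilizer_iff, smul_facetOf_eq_iff]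

theorem sameSide_mul_alcoveStab {w τ : ExtAffineWeyl P} (hτ : τ ∈ alcoveStab P (facetOf P p))
    {i : ι} {k : ℤ} : SameSide P i k p ((w * τ) • p) ↔ SameSide P i k p (w • p) := by
  have h : (w * τ) • p ∈ facetOf P (w • p) := by
    rw [mul_smul, smul_mem_facetOf_iff]; exact mem_alcoveStab_iff.1 hτ
  have := mem_facetOf.1 h i k
  exact ⟨fun h ↦ h.trans this, fun h ↦ h.trans this.symm⟩

/-- The strong exchange condition. -/
theorem exists_shorter_list [P.IsReduced] (l : List (ExtAffineWeyl P))
    (hl : ∀ s ∈ l, s ∈ simpleReflections P (facetOf P p)) (i : ι) (k : ℤ)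
    (h : ¬ SameSide P i k p (l.prod • p)) :
    ∃ l' : List (ExtAffineWeyl P), (∀ s ∈ l', s ∈ simpleReflections P (facetOf P p)) ∧
      l'.length < l.length ∧ l'.prod = affineReflection P i k * l.prod := by
  induction l generalizing i k with
  | nil => exact absurd (by simp [SameSide.refl]) h
  | cons s l ih =>
    have hl' : ∀ s ∈ l, s ∈ simpleReflections P (facetOf P p) := fun s hs ↦
      hl s (List.mem_cons_of_mem _ hs)
    have hs := hl s List.mem_cons_self
    obtain ⟨i₀, k₀, hw, hs'⟩ := hs
    -- If the hyperplane does not separate p from s p, it is transported by s to the tail of the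
    -- word. If it does, it is the wall of s, and the letter s is deleted.
    by_cases hsep : SameSide P i k p (s • p)
    · obtain ⟨j, m, hj, hr⟩ := exists_affine_root_inv s i k
      rw [List.prod_cons, mul_smul] at h
      have h1 : ¬ SameSide P j m p (l.prod • p) := fun h' ↦
        h (hsep.trans ((sameSide_smul_iff hj _ _).2 h'))
      obtain ⟨l', hl1, hl2, hl3⟩ := ih hl' j m h1
      refine ⟨s :: l', ?_, by simpa using hl2, ?_⟩
      · rintro t (_ | ⟨_, ht⟩)
        · exact ⟨i₀, k₀, hw, hs'⟩
        · exact hl1 t ht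
      · rw [List.prod_cons, List.prod_cons, hl3, hr]; group
    · rw [hs'] at hsep
      refine ⟨l, hl', by simp, ?_⟩
      rw [List.prod_cons, hs', affineReflection_eq_of_hyperplane_subset (hw.hyperplane_eq hsep).ge,
        affineReflection_mul_cancel_left]

variable [Finite ι] [P.IsReduced]

/-- The group generated by the simple reflections acts transitively on the alcoves. -/
theorem exists_mem_closure_smul (hp : IsGeneric P p) {q : Apartment Y} (hq : IsGeneric P q) :
    ∃ w ∈ Subgroup.closure (simpleReflections P (facetOf P p)), q ∈ facetOf P (w • p) := by
  suffices H : ∀ n, ∀ w ∈ Subgroup.closure (simpleReflections P (facetOf P p)),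
      (separating P (w • p) q).ncard = n →
      ∃ w ∈ Subgroup.closure (simpleReflections P (facetOf P p)), q ∈ facetOf P (w • p) from
    H _ 1 (one_mem _) rfl
  intro n
  induction n using Nat.strong_induction_on with
  | _ n ih =>
    intro w hw hn
    by_cases hqw : q ∈ facetOf P (w • p)
    · exact ⟨w, hw, hqw⟩
    obtain ⟨i, k, hik, hs⟩ := exists_wall_separating (hp.smul w) hq hqw
    refine ih _ (hn ▸ ncard_lt_ncard (hik.separating_ssubset (hp.smul w) hq hs)
      (separating_finite _ _)) (affineReflection P i k * w) ?_ (by rw [mul_smul])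
    have := mul_mem hw (Subgroup.subset_closure (mem_simpleReflections_of_isWall hik))
    rwa [← mul_assoc, ← mul_assoc, mul_inv_cancel, one_mul] at this

/-- The hyperplane is a wall of some alcove, and transitivity moves that alcove to the base one. -/
theorem affineReflection_mem_reflections (hp : IsGeneric P p) (i : ι) (k : ℤ) :
    affineReflection P i k ∈ reflections (simpleReflections P (facetOf P p)) := by
  obtain ⟨q, hq, hw⟩ := exists_isWall hp i k
  obtain ⟨w, hw', hqw⟩ := exists_mem_closure_smul hp hq
  rw [facetOf_eq hqw] at hw
  exact ⟨w, hw', _, mem_simpleReflections_of_isWall hw, by group⟩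

theorem closure_simpleReflections (hp : IsGeneric P p) :
    Subgroup.closure (simpleReflections P (facetOf P p)) = affineWeyl P := by
  refine le_antisymm (Subgroup.closure_mono ?_) ((Subgroup.closure_le _).2 ?_)
  · rintro _ ⟨i, k, -, rfl⟩
    exact ⟨i, k, rfl⟩
  · rintro _ ⟨i, k, rfl⟩
    obtain ⟨g, hg, s, hs, h⟩ := affineReflection_mem_reflections hp i k
    rw [h]
    exact mul_mem (mul_mem hg (Subgroup.subset_closure hs)) (inv_mem hg)

/-- The infimum defining `wordLength` is attained and is not the default value of an empty set,
because the simple reflections generate and are involutions. -/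
theorem exists_list_wordLength (hp : IsGeneric P p) {w : ExtAffineWeyl P} (hw : w ∈ affineWeyl P) :
    ∃ l : List (ExtAffineWeyl P), l.length = wordLength (simpleReflections P (facetOf P p)) w ∧
      (∀ s ∈ l, s ∈ simpleReflections P (facetOf P p)) ∧ l.prod = w := by
  refine Nat.sInf_mem (s := {n | ∃ l : List (ExtAffineWeyl P), l.length = n ∧
    (∀ s ∈ l, s ∈ simpleReflections P (facetOf P p)) ∧ l.prod = w}) ?_
  rw [← closure_simpleReflections hp] at hw
  rw [← Subgroup.mem_toSubmonoid, Subgroup.closure_toSubmonoid] at hw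
  obtain ⟨l, hl, h⟩ := Submonoid.exists_list_of_mem_closure hw
  refine ⟨l.length, l, rfl, fun s hs ↦ (hl s hs).elim id ?_, h⟩
  rintro ⟨i, k, hik, h⟩
  exact ⟨i, k, hik, by rw [← inv_inv s, h, affineReflection_inv]⟩

theorem wordLength_lt_of_not_sameSide (hp : IsGeneric P p) {w : ExtAffineWeyl P}
    (hw : w ∈ affineWeyl P) {i : ι} {k : ℤ} (h : ¬ SameSide P i k p (w • p)) :
    wordLength (simpleReflections P (facetOf P p)) (affineReflection P i k * w)
      < wordLength (simpleReflections P (facetOf P p)) w := by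
  obtain ⟨l, hl1, hl2, rfl⟩ := exists_list_wordLength hp hw
  obtain ⟨l', h1, h2, h3⟩ := exists_shorter_list l hl2 i k h
  rw [← h3, ← hl1]
  exact (wordLength_le h1).trans_lt h2

/-- Strong exchange gives one direction. Applied to the reflected element, which is then separated
from `p`, it gives the other. -/
theorem wordLength_affineReflection_mul_lt_iff (hp : IsGeneric P p) {w : ExtAffineWeyl P}
    (hw : w ∈ affineWeyl P) {i : ι} {k : ℤ} :
    wordLength (simpleReflections P (facetOf P p)) (affineReflection P i k * w)
      < wordLength (simpleReflections P (facetOf P p)) w ↔ ¬ SameSide P i k p (w • p) := by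
  refine ⟨fun h hs ↦ ?_, wordLength_lt_of_not_sameSide hp hw⟩
  have h1 := wordLength_lt_of_not_sameSide hp (mul_mem (affineReflection_mem P i k) hw)
    (i := i) (k := k) (by
      rw [mul_smul, sameSide_affineReflection_iff (hp i k) (hp.smul w i k), not_not]; exact hs)
  rw [affineReflection_mul_cancel_left] at h1
  exact h.asymm h1

/-- The affine Weyl group acts freely on the alcoves. -/
theorem eq_one_of_smul_mem_facetOf (hp : IsGeneric P p) {w : ExtAffineWeyl P}
    (hw : w ∈ affineWeyl P) (h : w • p ∈ facetOf P p) : w = 1 := by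
  obtain ⟨l, hl1, hl2, hl3⟩ := exists_list_wordLength hp hw
  match l with
  | [] => exact hl3.symm
  | s :: l =>
    exfalso
    obtain ⟨i, k, -, rfl⟩ := hl2 s List.mem_cons_self
    -- Removing the first letter of a shortest word shortens w, so the wall of that letter would
    -- separate p from w p, although both lie in one alcove.
    have h1 : affineReflection P i k * w = l.prod := by
      rw [← hl3, List.prod_cons, affineReflection_mul_cancel_left]
    have h2 : wordLength (simpleReflections P (facetOf P p)) (affineReflection P i k * w)
        < wordLength (simpleReflections P (facetOf P p)) w := by
      rw [h1, ← hl1]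
      exact (wordLength_le fun s hs ↦ hl2 s (List.mem_cons_of_mem _ hs)).trans_lt (by simp)
    exact (wordLength_affineReflection_mul_lt_iff hp hw).1 h2 (mem_facetOf.1 h i k).symm

theorem exists_eq_mul_alcoveStab (hp : IsGeneric P p) (u : ExtAffineWeyl P) :
    ∃ w ∈ affineWeyl P, ∃ τ ∈ alcoveStab P (facetOf P p), u = w * τ := by
  obtain ⟨w, hw, h⟩ := exists_mem_closure_smul hp (hp.smul u)
  rw [closure_simpleReflections hp] at hw
  refine ⟨w, hw, w⁻¹ * u, mem_alcoveStab_iff.2 ?_, by group⟩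
  rw [← smul_mem_facetOf_iff w, mul_smul, smul_inv_smul]
  exact h

/-- Freeness on alcoves makes the decomposition w τ unique, so the infimum defining `length` runs
over a single value. -/
theorem length_mul_alcoveStab (hp : IsGeneric P p) {w τ : ExtAffineWeyl P} (hw : w ∈ affineWeyl P)
    (hτ : τ ∈ alcoveStab P (facetOf P p)) :
    length P (facetOf P p) (w * τ) = wordLength (simpleReflections P (facetOf P p)) w := by
  have : {n | ∃ w' ∈ affineWeyl P, ∃ τ' ∈ alcoveStab P (facetOf P p), w * τ = w' * τ' ∧
      n = wordLength (simpleReflections P (facetOf P p)) w'}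
      = {wordLength (simpleReflections P (facetOf P p)) w} := by
    ext n
    constructor
    · rintro ⟨w', hw', τ', hτ', h, rfl⟩
      have h1 : w'⁻¹ * w = τ' * τ⁻¹ := by
        rw [eq_mul_inv_iff_mul_eq, mul_assoc, h, inv_mul_cancel_left]
      have h2 := eq_one_of_smul_mem_facetOf hp (mul_mem (inv_mem hw') hw)
        (mem_alcoveStab_iff.1 (h1 ▸ mul_mem hτ' (inv_mem hτ)))
      rw [inv_mul_eq_one.1 h2]
      rfl
    · rintro rfl
      exact ⟨w, hw, τ, hτ, rfl, rfl⟩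
  rw [length, this, csInf_singleton]

theorem length_affineReflection_mul_lt_iff (hp : IsGeneric P p) {u : ExtAffineWeyl P} {i : ι}
    {k : ℤ} : length P (facetOf P p) (affineReflection P i k * u) < length P (facetOf P p) u ↔
      ¬ SameSide P i k p (u • p) := by
  obtain ⟨w, hw, τ, hτ, rfl⟩ := exists_eq_mul_alcoveStab hp u
  rw [← mul_assoc, length_mul_alcoveStab hp (mul_mem (affineReflection_mem P i k) hw) hτ,
    length_mul_alcoveStab hp hw hτ, wordLength_affineReflection_mul_lt_iff hp hw,
    sameSide_mul_alcoveStab hτ]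

variable (P) in
/-- The elementary relations `u < t u` of the Bruhat order: `t` is the reflection across a
hyperplane that does not separate the alcove of `p` from its image under `u`. -/
def BruhatStep (p : Apartment Y) (u v : ExtAffineWeyl P) : Prop :=
  ∃ i k, v = affineReflection P i k * u ∧ SameSide P i k p (u • p)

theorem BruhatStep.length_lt (hp : IsGeneric P p) {u v : ExtAffineWeyl P}
    (h : BruhatStep P p u v) : length P (facetOf P p) u < length P (facetOf P p) v := by
  obtain ⟨i, k, rfl, h⟩ := h
  have := (length_affineReflection_mul_lt_iff hp (u := affineReflection P i k * u) (i := i)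
    (k := k)).2 (by
      rw [mul_smul, sameSide_affineReflection_iff (hp i k) (hp.smul u i k), not_not]; exact h)
  rwa [affineReflection_mul_cancel_left] at this

variable (P) in
/-- The Bruhat order, in terms of a point of the alcove. -/
abbrev BruhatRel (p : Apartment Y) : ExtAffineWeyl P → ExtAffineWeyl P → Prop :=
  Relation.ReflTransGen (BruhatStep P p)

theorem length_le_of_bruhatRel (hp : IsGeneric P p) {u v : ExtAffineWeyl P}
    (h : BruhatRel P p u v) : length P (facetOf P p) u ≤ length P (facetOf P p) v := by
  induction h with
  | refl => exact le_rfl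
  | tail _ h ih => exact ih.trans (h.length_lt hp).le

theorem eq_of_bruhatRel_of_length_le (hp : IsGeneric P p) {u v : ExtAffineWeyl P}
    (h : BruhatRel P p u v) (hl : length P (facetOf P p) v ≤ length P (facetOf P p) u) : u = v := by
  cases h with
  | refl => rfl
  | tail h' h => exact absurd ((length_le_of_bruhatRel hp h').trans_lt (h.length_lt hp)) hl.not_gt

/-- Left multiplication by reflections keeps the factor τ, and τ does not affect sides because it
preserves the alcove. The length condition in the Coxeter order is exactly the side condition of
`BruhatStep`. -/
theorem bruhatLE_iff (hp : IsGeneric P p) {u v : ExtAffineWeyl P} :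
    BruhatLE P (facetOf P p) u v ↔ BruhatRel P p u v := by
  constructor
  · rintro ⟨w, hw, w', -, τ, hτ, rfl, rfl, h⟩
    suffices H : w' ∈ affineWeyl P ∧ BruhatRel P p (w * τ) (w' * τ) from H.2
    induction h with
    | refl => exact ⟨hw, .refl⟩
    | tail _ h ih =>
      obtain ⟨t, ht, rfl, hlt⟩ := h
      obtain ⟨i, k, rfl⟩ := exists_eq_affineReflection_of_mem_reflections ht
      refine ⟨mul_mem (affineReflection_mem P i k) ih.1, ih.2.tail ⟨i, k, mul_assoc _ _ _, ?_⟩⟩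
      rw [sameSide_mul_alcoveStab hτ]
      exact not_not.1 ((wordLength_affineReflection_mul_lt_iff hp ih.1).not.1 hlt.not_gt)
  · intro h
    obtain ⟨w, hw, τ, hτ, rfl⟩ := exists_eq_mul_alcoveStab hp u
    suffices H : ∃ w' ∈ affineWeyl P, v = w' * τ ∧
        CoxeterBruhatLE (simpleReflections P (facetOf P p)) w w' by
      obtain ⟨w', hw', rfl, h'⟩ := H
      exact ⟨w, hw, w', hw', τ, hτ, rfl, rfl, h'⟩
    induction h with
    | refl => exact ⟨w, hw, rfl, .refl⟩
    | tail _ h ih =>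
      obtain ⟨w', hw', rfl, ih⟩ := ih
      have hlen := h.length_lt hp
      obtain ⟨i, k, rfl, h⟩ := h
      have hm := mul_mem (affineReflection_mem P i k) hw'
      refine ⟨_, hm, (mul_assoc _ _ _).symm, ih.tail
        ⟨_, affineReflection_mem_reflections hp i k, rfl, ?_⟩⟩
      rwa [← mul_assoc, length_mul_alcoveStab hp hw' hτ, length_mul_alcoveStab hp hm hτ] at hlen

end Combinatorics

/-! ### Minimal representatives of cosets and double cosets -/

section DoubleCoset

variable {ι X Y : Type*} [AddCommGroup X] [AddCommGroup Y] {P : RootDatum ι X Y}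
  {p x x₁ x₂ : Apartment Y}

theorem mem_facetStab_iff {y : ExtAffineWeyl P} :
    y ∈ facetStab P (facetOf P x) ↔ y ∈ affineWeyl P ∧ y • x ∈ facetOf P x := by
  rw [facetStab, Subgroup.mem_inf, MulAction.mem_stabilizer_iff, smul_facetOf_eq_iff]

theorem affineReflection_mem_facetStab {i : ι} {k : ℤ} (h : rootForm P i x = k) :
    affineReflection P i k ∈ facetStab P (facetOf P x) := by
  refine mem_facetStab_iff.2 ⟨affineReflection_mem P i k, ?_⟩
  rw [affineReflection_smul_of_mem P h]
  exact mem_facetOf_self x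

theorem conj_mem_facetStab {y : ExtAffineWeyl P} (hy : y ∈ facetStab P (facetOf P x))
    (u : ExtAffineWeyl P) : u * y * u⁻¹ ∈ facetStab P (facetOf P (u • x)) := by
  obtain ⟨h1, h2⟩ := mem_facetStab_iff.1 hy
  refine mem_facetStab_iff.2 ⟨(affineWeyl_normal P).conj_mem y h1 u, ?_⟩
  rw [mul_smul, inv_smul_smul, mul_smul, smul_mem_facetOf_iff]
  exact h2

/-- The stabilizer of the facet of `x` permutes the alcoves around `x`. Hence it can change sides
only with respect to hyperplanes through `x`. -/
theorem Adheres.smul_of_mem_facetStab (h : Adheres P x p) {y : ExtAffineWeyl P}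
    (hy : y ∈ facetStab P (facetOf P x)) : Adheres P x (y • p) := by
  refine (h.smul y).of_mem_facetOf fun i k ↦ ?_
  exact (mem_facetOf.1 (mem_facetStab_iff.1 hy).2 i k).symm

theorem eq_iff_of_mem_facetStab {y : ExtAffineWeyl P} (hy : y ∈ facetStab P (facetOf P x))
    {i j : ι} {k l : ℤ} (h : ∀ z : Apartment Y, rootForm P j (y • z) - l = rootForm P i z - k) :
    rootForm P j x = l ↔ rootForm P i x = k := by
  rw [← eq_iff_of_affine_root h, (mem_facetOf.1 (mem_facetStab_iff.1 hy).2 j l).eq_iff]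

variable (P) in
/-- No hyperplane through `x` separates the alcove of `p` from its image under `u`. -/
def IsMinimalAt (p x : Apartment Y) (u : ExtAffineWeyl P) : Prop :=
  ∀ (i : ι) (k : ℤ), rootForm P i x = k → SameSide P i k p (u • p)

variable (P) in
/-- The elements of minimal length of the double cosets of the stabilizers of the facets of `x₁`
and `x₂`. -/
structure IsBiminimal (p x₁ x₂ : Apartment Y) (u : ExtAffineWeyl P) : Prop where
  left : IsMinimalAt P p x₁ u
  right : IsMinimalAt P p x₂ u⁻¹

/-- The lifting property of the Bruhat order. -/
theorem BruhatRel.affineReflection_mul [P.IsReduced] {i : ι} {k : ℤ}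
    (hw : IsWall P (facetOf P p) i k) {u v : ExtAffineWeyl P} (h : BruhatRel P p u v) (hv : SameSide P i k p (v • p)) :
    BruhatRel P p (affineReflection P i k * u) (affineReflection P i k * v) := by
  induction h using Relation.ReflTransGen.head_induction_on with
  | refl => exact .refl
  | head h h' ih =>
    obtain ⟨j, l, rfl, hs⟩ := h
    obtain ⟨j', l', hj, hr⟩ := exists_affine_root P (affineReflection P i k) j l
    -- Write s for the wall reflection and r for that of the first step. If s H does not separate p
    -- from s p, then s u → s r u is again a step. Otherwise r = s, and the chain s u = r u ≤ v is
    -- completed by the step v → s v.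
    by_cases hside : SameSide P j' l' p (affineReflection P i k • p)
    · refine .head ⟨j', l', by rw [hr]; group, hside.trans ?_⟩ ih
      rw [mul_smul]
      exact (sameSide_smul_iff hj _ _).2 hs
    · have h1 := affineReflection_eq_of_hyperplane_subset (hw.hyperplane_eq hside).ge
      rw [hr, mul_inv_eq_iff_eq_mul, mul_right_inj] at h1
      rw [h1] at h'
      exact .tail h' ⟨i, k, rfl, hv⟩

variable [Finite ι] [P.IsReduced]

/-- As long as a hyperplane through `x` separates, reflecting across it stays in the coset and
lowers the length. -/
theorem exists_isMinimalAt (hp : IsGeneric P p) (x : Apartment Y) (z : ExtAffineWeyl P) :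
    ∃ y ∈ facetStab P (facetOf P x), BruhatRel P p (y * z) z ∧ IsMinimalAt P p x (y * z) := by
  induction hn : length P (facetOf P p) z using Nat.strong_induction_on generalizing z with
  | _ n ih =>
    by_cases hz : IsMinimalAt P p x z
    · exact ⟨1, one_mem _, by rw [one_mul], by rwa [one_mul]⟩
    rw [IsMinimalAt] at hz
    push Not at hz
    obtain ⟨i, k, hik, hs⟩ := hz
    obtain ⟨y, hy, h1, h2⟩ := ih _ (hn ▸ (length_affineReflection_mul_lt_iff hp).2 hs)
      (affineReflection P i k * z) rfl
    refine ⟨y * affineReflection P i k, mul_mem hy (affineReflection_mem_facetStab hik), ?_, ?_⟩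
    · rw [mul_assoc]
      refine h1.tail ⟨i, k, (affineReflection_mul_cancel_left P i k z).symm, ?_⟩
      rw [mul_smul, sameSide_affineReflection_iff (hp i k) (hp.smul z i k)]
      exact hs
    · rwa [mul_assoc]

/-- Uniqueness of the minimal element of a coset: `y` fixes the alcove of `c`. For hyperplanes
through `x` the points y c, y u p, p, u p, c are successively on the same side; for the others both
alcoves adhere to `x`. The auxiliary `c` allows c = p for left cosets and c = u p for right cosets.
-/
theorem eq_one_of_isMinimalAt {y u : ExtAffineWeyl P}
    (hy : y ∈ facetStab P (facetOf P x)) (hu : IsMinimalAt P p x u)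
    (hyu : IsMinimalAt P p x (y * u)) {c : Apartment Y} (hc : IsGeneric P c) (hxc : Adheres P x c)
    (hcu : ∀ (i : ι) (k : ℤ), rootForm P i x = k → SameSide P i k c (u • p)) : y = 1 := by
  refine eq_one_of_smul_mem_facetOf hc (mem_facetStab_iff.1 hy).1 fun i k ↦ ?_
  by_cases hik : rootForm P i x = k
  · obtain ⟨j, l, hj, -⟩ := exists_affine_root_inv y i k
    have h1 := hcu j l ((eq_iff_of_mem_facetStab hy hj).1 hik)
    have h2 := (sameSide_smul_iff hj _ _).2 h1
    rw [← mul_smul] at h2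
    exact h2.trans ((hyu i k hik).symm.trans ((hu i k hik).trans (hcu i k hik).symm))
  · exact (hxc.smul_of_mem_facetStab hy).sameSide hxc hik

/-- Descending from y u within its coset ends at a minimal element, which must be `u` by uniqueness.
-/
theorem IsMinimalAt.bruhatRel_mul (hp : IsGeneric P p) {y u : ExtAffineWeyl P}
    (hu : IsMinimalAt P p x u) (hy : y ∈ facetStab P (facetOf P x))
    {c : Apartment Y} (hc : IsGeneric P c) (hxc : Adheres P x c)
    (hcu : ∀ (i : ι) (k : ℤ), rootForm P i x = k → SameSide P i k c (u • p)) :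
    BruhatRel P p u (y * u) := by
  obtain ⟨y₀, hy₀, h1, h2⟩ := exists_isMinimalAt hp x (y * u)
  have h3 : y₀ * y = 1 := by
    rw [← mul_assoc] at h2
    exact eq_one_of_isMinimalAt (mul_mem hy₀ hy) hu h2 hc hxc hcu
  rwa [← mul_assoc, h3, one_mul] at h1

theorem IsMinimalAt.bruhatRel_mul_left (hp : IsGeneric P p) (hx : Adheres P x p)
    {y u : ExtAffineWeyl P} (hu : IsMinimalAt P p x u) (hy : y ∈ facetStab P (facetOf P x)) :
    BruhatRel P p u (y * u) :=
  hu.bruhatRel_mul hp hy hp hx hu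

/-- Right multiplication by `y` is left multiplication by u y u⁻¹, which stabilizes the facet of u
x. The preceding argument applies there with c = u p. -/
theorem IsMinimalAt.bruhatRel_mul_right (hp : IsGeneric P p) (hx : Adheres P x p)
    {y u : ExtAffineWeyl P} (hu : IsMinimalAt P p x u⁻¹) (hy : y ∈ facetStab P (facetOf P x)) :
    BruhatRel P p u (u * y) := by
  have h := IsMinimalAt.bruhatRel_mul (x := u • x) (u := u) hp (fun i k hik ↦ ?_)
    (conj_mem_facetStab hy u) (hp.smul u) (hx.smul u) fun i k _ ↦ SameSide.refl
  · rwa [inv_mul_cancel_right] at h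
  · obtain ⟨j, l, hj, -⟩ := exists_affine_root_inv u i k
    have h1 := (sameSide_smul_iff hj _ _).2 (hu j l ((eq_iff_of_affine_root hj x).1 hik))
    rw [smul_inv_smul] at h1
    exact h1.symm

/-- The element of minimal length of a coset lies below all elements of larger cosets. -/
theorem BruhatRel.minimal_mono (hp : IsGeneric P p) (hx : Adheres P x p)
    {u v y y' : ExtAffineWeyl P} (h : BruhatRel P p u v) (hy : y ∈ facetStab P (facetOf P x))
    (hy' : y' ∈ facetStab P (facetOf P x)) (hu : IsMinimalAt P p x (y * u)) :
    BruhatRel P p (y * u) (y' * v) := by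
  induction h using Relation.ReflTransGen.head_induction_on generalizing y with
  | refl =>
    have := hu.bruhatRel_mul_left hp hx (mul_mem hy' (inv_mem hy))
    rwa [mul_assoc, inv_mul_cancel_left] at this
  | head h _ ih =>
    obtain ⟨y₁, hy₁, -, h1⟩ := exists_isMinimalAt hp x _
    refine .trans ?_ (ih hy₁ h1)
    obtain ⟨i, k, rfl, hs⟩ := h
    -- If the hyperplane passes through x, the step stays in one coset. Otherwise, conjugating by y₁
    -- gives a hyperplane not through x, which cannot separate p from y₁ p, so y₁ u → y₁ t u is
    -- again a step.
    by_cases hik : rootForm P i x = k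
    · have := hu.bruhatRel_mul_left hp hx
        (mul_mem (mul_mem hy₁ (affineReflection_mem_facetStab hik)) (inv_mem hy))
      rwa [mul_assoc, inv_mul_cancel_left, mul_assoc] at this
    · have h2 := hu.bruhatRel_mul_left hp hx (mul_mem hy₁ (inv_mem hy))
      rw [mul_assoc, inv_mul_cancel_left] at h2
      refine h2.tail ?_
      obtain ⟨j, l, hj, hr⟩ := exists_affine_root P y₁ i k
      refine ⟨j, l, by rw [hr]; group, ?_⟩
      have h3 := (sameSide_smul_iff hj _ _).2 hs
      rw [← mul_smul] at h3
      refine SameSide.trans ?_ h3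
      exact hx.sameSide (hx.smul_of_mem_facetStab hy₁) fun h ↦
        hik ((eq_iff_of_mem_facetStab hy₁ hj).1 h)

/-- Right minimality gives u ≤ u y₂. Monotonicity of left minimal elements then puts `u` below the
minimal element of the left coset of y₁ u y₂. -/
theorem IsBiminimal.bruhatRel (hp : IsGeneric P p) (hx₁ : Adheres P x₁ p) (hx₂ : Adheres P x₂ p)
    {u y₁ y₂ : ExtAffineWeyl P} (hu : IsBiminimal P p x₁ x₂ u)
    (hy₁ : y₁ ∈ facetStab P (facetOf P x₁)) (hy₂ : y₂ ∈ facetStab P (facetOf P x₂)) :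
    BruhatRel P p u (y₁ * u * y₂) := by
  have h1 := hu.right.bruhatRel_mul_right hp hx₂ hy₂
  obtain ⟨y, hy, h2, -⟩ := exists_isMinimalAt hp x₁ (y₁ * u * y₂)
  have h4 := h1.minimal_mono hp hx₁ (one_mem _) (mul_mem hy hy₁) (by simpa using hu.left)
  rw [one_mul] at h4
  refine h4.trans ?_
  simpa only [mul_assoc] using h2

/-- A separating hyperplane through `x₁`, or the image under `u` of one through `x₂`, yields a
shorter element of the same double coset. Conversely a biminimal element is below the whole double
coset. -/
theorem isMinRep_iff (hp : IsGeneric P p) (hx₁ : Adheres P x₁ p) (hx₂ : Adheres P x₂ p)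
    {D : DoubleCosets P (facetOf P x₁) (facetOf P x₂)} {u : ExtAffineWeyl P} :
    IsMinRep (facetOf P p) D u ↔
      DoubleCoset.mk (facetStab P (facetOf P x₁)) (facetStab P (facetOf P x₂)) u = D ∧
        IsBiminimal P p x₁ x₂ u := by
  constructor
  · rintro ⟨rfl, h⟩
    refine ⟨rfl, ⟨fun i k hik ↦ ?_, fun i k hik ↦ ?_⟩⟩
    · by_contra hs
      refine ((length_affineReflection_mul_lt_iff hp).2 hs).not_ge (h _ ?_)
      exact ((DoubleCoset.eq _ _ _ _).2 ⟨_, affineReflection_mem_facetStab hik, 1, one_mem _,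
        by rw [mul_one]⟩).symm
    · obtain ⟨j, l, hj, hr⟩ := exists_affine_root P u i k
      by_contra hs
      have hs' := (sameSide_smul_iff hj (u⁻¹ • p) p).not.2 fun h' ↦ hs h'.symm
      rw [smul_inv_smul] at hs'
      refine ((length_affineReflection_mul_lt_iff hp).2 hs').not_ge (h _ ?_)
      exact ((DoubleCoset.eq _ _ _ _).2 ⟨1, one_mem _, _, affineReflection_mem_facetStab hik,
        by rw [hr]; group⟩).symm
  · rintro ⟨rfl, h⟩
    refine ⟨rfl, fun v hv ↦ ?_⟩
    obtain ⟨y₁, hy₁, y₂, hy₂, rfl⟩ := (DoubleCoset.eq _ _ _ _).1 hv.symm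
    exact length_le_of_bruhatRel hp (h.bruhatRel hp hx₁ hx₂ hy₁ hy₂)

theorem exists_isBiminimal (hp : IsGeneric P p) (hx₁ : Adheres P x₁ p) (hx₂ : Adheres P x₂ p)
    (D : DoubleCosets P (facetOf P x₁) (facetOf P x₂)) :
    ∃ u, DoubleCoset.mk (facetStab P (facetOf P x₁)) (facetStab P (facetOf P x₂)) u = D ∧
        IsBiminimal P p x₁ x₂ u := by
  have hne : {u | DoubleCoset.mk (facetStab P (facetOf P x₁)) (facetStab P (facetOf P x₂)) u
      = D}.Nonempty := ⟨_, DoubleCoset.out_eq' _ _ D⟩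
  refine ⟨_, (isMinRep_iff hp hx₁ hx₂).1 ⟨Function.argminOn_mem (length P (facetOf P p)) _ hne,
    fun v hv ↦ Function.argminOn_le (length P (facetOf P p))
      {u | DoubleCoset.mk (facetStab P (facetOf P x₁)) (facetStab P (facetOf P x₂)) u = D} hv⟩⟩

theorem IsBiminimal.eq (hp : IsGeneric P p) (hx₁ : Adheres P x₁ p) (hx₂ : Adheres P x₂ p)
    {u v : ExtAffineWeyl P} (hu : IsBiminimal P p x₁ x₂ u) (hv : IsBiminimal P p x₁ x₂ v)
    (h : DoubleCoset.mk (facetStab P (facetOf P x₁)) (facetStab P (facetOf P x₂)) u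
      = DoubleCoset.mk (facetStab P (facetOf P x₁)) (facetStab P (facetOf P x₂)) v) : u = v := by
  obtain ⟨y₁, hy₁, y₂, hy₂, h1⟩ := (DoubleCoset.eq _ _ _ _).1 h
  obtain ⟨z₁, hz₁, z₂, hz₂, h2⟩ := (DoubleCoset.eq _ _ _ _).1 h.symm
  exact eq_of_bruhatRel_of_length_le hp (h1 ▸ hu.bruhatRel hp hx₁ hx₂ hy₁ hy₂)
    (length_le_of_bruhatRel hp (h2 ▸ hv.bruhatRel hp hx₁ hx₂ hz₁ hz₂))

theorem doubleCosetBruhatLE_iff (hp : IsGeneric P p) (hx₁ : Adheres P x₁ p) (hx₂ : Adheres P x₂ p)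
    {u v : ExtAffineWeyl P} (hu : IsBiminimal P p x₁ x₂ u) (hv : IsBiminimal P p x₁ x₂ v) :
    DoubleCosetBruhatLE (facetOf P p)
      (DoubleCoset.mk (facetStab P (facetOf P x₁)) (facetStab P (facetOf P x₂)) u)
      (DoubleCoset.mk (facetStab P (facetOf P x₁)) (facetStab P (facetOf P x₂)) v) ↔
      BruhatRel P p u v := by
  constructor
  · rintro ⟨u', v', hu', hv', h⟩
    rw [isMinRep_iff hp hx₁ hx₂] at hu' hv'
    rw [bruhatLE_iff hp, hu'.2.eq hp hx₁ hx₂ hu hu'.1, hv'.2.eq hp hx₁ hx₂ hv hv'.1] at h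
    exact h
  · intro h
    exact ⟨u, v, (isMinRep_iff hp hx₁ hx₂).2 ⟨rfl, hu⟩, (isMinRep_iff hp hx₁ hx₂).2 ⟨rfl, hv⟩,
      (bruhatLE_iff hp).2 h⟩

end DoubleCoset

/-! ### Comparison of hyperplanes and facets of R and R^[Θ] -/

section FixedPart

variable {ι X Y : Type*} [AddCommGroup X] [AddCommGroup Y] {P : RootDatum ι X Y} {b : P.Base}

theorem IsFacet.exists_eq_facetOf_fixedIncl {Θ : BasedAut P b} {f : Set (Apartment Y)}
    (hf : IsFacet P f) (h : (fixedPart Θ f).Nonempty) :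
    ∃ p : Apartment (fixedCochar Θ), f = facetOf P (fixedIncl Θ p) := by
  obtain ⟨q, rfl⟩ := hf
  obtain ⟨p, hp⟩ := h
  have hp' : fixedIncl Θ p ∈ facetOf P q := hp
  exact ⟨p, (facetOf_eq hp').symm⟩

end FixedPart

section FixedPoints

variable {ι X Y : Type*} [AddCommGroup X] [AddCommGroup Y]
  {P : RootDatum ι X Y} {b : P.Base} (Θ : BasedAut P b)

theorem fixedIncl_tmul (r : ℝ) (y : fixedCochar Θ) : fixedIncl Θ (r ⊗ₜ y) = r ⊗ₜ (y : Y) := rfl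

/-- The factor 1 gives the shape of `exists_fixedRoot`, so that the same comparison lemmas serve to
pass from R to R^[Θ] and back. -/
theorem exists_resRoot_eq (a : fixedRoots Θ) :
    ∃ i, (a : Dual ℤ (fixedCochar Θ)) = (1 : ℤ) • resRoot Θ i := by
  obtain ⟨i, hi⟩ := a.2.1
  exact ⟨i, by rw [one_smul, hi]⟩

/-- Every restricted root has a positive multiple in `R^{[Θ]}`. -/
theorem exists_fixedRoot [Finite ι] (i : ι) :
    ∃ a : fixedRoots Θ, ∃ n : ℤ, 0 < n ∧ (a : Dual ℤ (fixedCochar Θ)) = n • resRoot Θ i := by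
  by_contra! hcon
  -- Doubling must stop: otherwise all multiples by powers of 2 would be restrictions of roots, and
  -- there are only finitely many of these.
  have h1 : ∀ m : ℕ, ((2 : ℤ) ^ m) • resRoot Θ i ∈ range (resRoot Θ) := fun m ↦ by
    induction m with
    | zero => exact ⟨i, by simp⟩
    | succ m ih =>
      by_contra h
      refine hcon ⟨_, ih, fun h' ↦ h ?_⟩ (2 ^ m) (by positivity) rfl
      rwa [pow_succ', mul_smul, ofNat_smul_eq_nsmul]
  refine infinite_of_injective_forall_mem (f := fun m : ℕ ↦ ((2 : ℤ) ^ m) • resRoot Θ i) ?_ h1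
    (finite_range _)
  intro m n hmn
  have := smul_left_injective ℤ (resRoot_ne_zero Θ i) hmn
  exact Int.pow_right_injective (le_refl 2) this

theorem finite_fixedRoots [Finite ι] : Finite (fixedRoots Θ) :=
  Finite.Set.subset (range (resRoot Θ)) fun _ ha ↦ ha.1

theorem neg_resRoot_mem_range (i : ι) : -resRoot Θ i ∈ range (resRoot Θ) := by
  refine ⟨P.reflectionPerm i i, ?_⟩
  ext y
  change P.toLinearMap (P.root (P.reflectionPerm i i)) (y : Y) = -P.toLinearMap (P.root i) (y : Y)
  rw [P.root_reflectionPerm, P.reflection_apply_self, map_neg, LinearMap.neg_apply]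

variable [Finite ι] [Module.Finite ℤ Y]

theorem steinberg_root' (a : fixedRoots Θ) : (steinberg Θ).root' a = a := rfl

theorem steinberg_coroot (a : fixedRoots Θ) : (steinberg Θ).coroot a = fixedCoroot Θ a := rfl

theorem rootForm_steinberg {a : fixedRoots Θ} {i : ι} {n : ℤ} 
    (h : (a : Dual ℤ (fixedCochar Θ)) = n • resRoot Θ i) (p : Apartment (fixedCochar Θ)) :
    rootForm (steinberg Θ) a p = n * rootForm P i (fixedIncl Θ p) := by
  induction p using TensorProduct.induction_on with
  | zero => simp
  | tmul r y =>
    rw [fixedIncl_tmul, rootForm_tmul, rootForm_tmul, steinberg_root', h, LinearMap.smul_apply]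
    change r * ((n • P.root' i (y : Y) : ℤ) : ℝ) = _
    push_cast [smul_eq_mul]
    ring
  | add p q hp hq => rw [map_add, map_add, map_add, hp, hq, mul_add]

/-- On A^[Θ] the affine root a - nk is the positive multiple n (α_i - k). Used with n = 1 to start
from a root of R^[Θ], and with the n of `exists_fixedRoot` to start from a root of R. -/
theorem sameSide_steinberg {a : fixedRoots Θ} {i : ι} {n : ℤ} (hn : 0 < n)
    (h : (a : Dual ℤ (fixedCochar Θ)) = n • resRoot Θ i) (k : ℤ) (p q : Apartment (fixedCochar Θ)) :
    SameSide (steinberg Θ) a (n * k) p q ↔ SameSide P i k (fixedIncl Θ p) (fixedIncl Θ q) := by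
  have hn' : (0 : ℝ) < n := Int.cast_pos.2 hn
  have this (p) : rootForm (steinberg Θ) a p - ((n * k : ℤ) : ℝ)
      = n * (rootForm P i (fixedIncl Θ p) - k) := by
    rw [rootForm_steinberg Θ h]; push_cast; ring
  rw [SameSide, SameSide, this, this, sign_mul, sign_mul, sign_pos hn', one_mul, one_mul]

theorem rootForm_steinberg_eq_iff {a : fixedRoots Θ} {i : ι} {n : ℤ} (hn : 0 < n)
    (h : (a : Dual ℤ (fixedCochar Θ)) = n • resRoot Θ i) (k : ℤ) (p : Apartment (fixedCochar Θ)) :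
    rootForm (steinberg Θ) a p = ((n * k : ℤ) : ℝ) ↔ rootForm P i (fixedIncl Θ p) = k := by
  have hn' : (n : ℝ) ≠ 0 := Int.cast_ne_zero.2 hn.ne'
  rw [rootForm_steinberg Θ h, Int.cast_mul, mul_right_inj' hn']

theorem isGeneric_fixedIncl_iff {p : Apartment (fixedCochar Θ)} :
    IsGeneric P (fixedIncl Θ p) ↔ IsGeneric (steinberg Θ) p := by
  constructor
  · intro h a k hk
    obtain ⟨i, hi⟩ := exists_resRoot_eq Θ a
    rw [← one_mul k, rootForm_steinberg_eq_iff Θ one_pos hi] at hk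
    exact h i k hk
  · intro h i k hk
    obtain ⟨a, n, hn, ha⟩ := exists_fixedRoot Θ i
    exact h a (n * k) ((rootForm_steinberg_eq_iff Θ hn ha k p).2 hk)

theorem adheres_fixedIncl_iff {x p : Apartment (fixedCochar Θ)} :
    Adheres P (fixedIncl Θ x) (fixedIncl Θ p) ↔ Adheres (steinberg Θ) x p := by
  constructor
  · intro h a k hk
    obtain ⟨i, hi⟩ := exists_resRoot_eq Θ a
    rw [← one_mul k] at hk ⊢
    rw [Ne, rootForm_steinberg_eq_iff Θ one_pos hi] at hk
    exact (sameSide_steinberg Θ one_pos hi k _ _).2 (h i k hk)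
  · intro h i k hk
    obtain ⟨a, n, hn, ha⟩ := exists_fixedRoot Θ i
    exact (sameSide_steinberg Θ hn ha k _ _).1
      (h a (n * k) ((rootForm_steinberg_eq_iff Θ hn ha k x).not.2 hk))

theorem fixedIncl_mem_facetOf_iff {p q : Apartment (fixedCochar Θ)} :
    fixedIncl Θ q ∈ facetOf P (fixedIncl Θ p) ↔ q ∈ facetOf (steinberg Θ) p := by
  constructor
  · intro h a k
    obtain ⟨i, hi⟩ := exists_resRoot_eq Θ a
    have := (sameSide_steinberg Θ one_pos hi k _ _).2 (h i k)
    rwa [one_mul] at this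
  · intro h i k
    obtain ⟨a, n, hn, ha⟩ := exists_fixedRoot Θ i
    exact (sameSide_steinberg Θ hn ha k _ _).1 (h a (n * k))

theorem fixedPart_facetOf (p : Apartment (fixedCochar Θ)) :
    fixedPart Θ (facetOf P (fixedIncl Θ p)) = facetOf (steinberg Θ) p :=
  ext fun _ ↦ fixedIncl_mem_facetOf_iff Θ

/-- For proportional roots, m = c(a^∨) and n = a(c^∨) satisfy m n = 4 and 2c = m a. The case m = ±2
gives c = ±a. Otherwise one of the two is, up to sign, twice the other, which the definition of
R^[Θ] excludes. -/
instance steinberg_isReduced : (steinberg Θ).IsReduced := by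
  refine ⟨fun a c h ↦ ?_⟩
  change (a : Dual ℤ (fixedCochar Θ)) = c ∨ (a : Dual ℤ (fixedCochar Θ)) = -c
  change ¬ LinearIndependent ℤ ![(a : Dual ℤ (fixedCochar Θ)), (c : Dual ℤ (fixedCochar Θ))] at h
  obtain ⟨a, ha⟩ := a
  obtain ⟨c, hc⟩ := c
  dsimp only at h ⊢
  have hneg : ∀ {a}, a ∈ range (resRoot Θ) → -a ∈ range (resRoot Θ) := by
    rintro _ ⟨i, rfl⟩
    exact neg_resRoot_mem_range Θ i
  have hne : ∀ {a}, a ∈ fixedRoots Θ → a ≠ 0 := by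
    rintro _ ⟨⟨i, rfl⟩, -⟩
    exact resRoot_ne_zero Θ i
  rw [LinearIndependent.pair_iff] at h
  push Not at h
  obtain ⟨s, t, hst, hst0⟩ := h
  have ht : t ≠ 0 := by
    rintro rfl
    rw [zero_smul, add_zero, smul_eq_zero] at hst
    exact hst0 (hst.resolve_right (hne ha)) rfl
  have hs : s ≠ 0 := by
    rintro rfl
    rw [zero_smul, zero_add, smul_eq_zero] at hst
    exact ht (hst.resolve_right (hne hc))
  have h1 := LinearMap.congr_fun hst (fixedCoroot Θ a)
  have h2 := LinearMap.congr_fun hst (fixedCoroot Θ c)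
  simp only [LinearMap.add_apply, LinearMap.smul_apply, smul_eq_mul, LinearMap.zero_apply,
    fixedRoot_coroot_two Θ ha, fixedRoot_coroot_two Θ hc] at h1 h2
  set m := c (fixedCoroot Θ a)
  set n := a (fixedCoroot Θ c)
  have hmn : m * n = 4 := by
    apply mul_left_cancel₀ (mul_ne_zero hs ht)
    linear_combination (-2 * t) * h1 + (t * m) * h2
  have hca : (2 : ℤ) • c = m • a := by
    have : t • ((2 : ℤ) • c) = t • (m • a) := by
      have h3 : t * m = -(s * 2) := by linarith
      have h4 : t • c = -(s • a) := by rw [eq_neg_iff_add_eq_zero, add_comm]; exact hst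
      rw [smul_comm, h4, smul_smul t m, h3]; module
    exact smul_right_injective _ ht this
  have h2c : ∀ x y : Dual ℤ (fixedCochar Θ), (2 : ℤ) • x = (2 : ℤ) • y → x = y := fun x y h ↦
    smul_right_injective _ (two_ne_zero' ℤ) h
  have hm : m = 1 ∨ m = -1 ∨ m = 2 ∨ m = -2 ∨ m = 4 ∨ m = -4 := by
    have h5 : m ≤ 4 := Int.le_of_dvd (by norm_num) (Dvd.intro _ hmn)
    have h6 : -m ≤ 4 := Int.le_of_dvd (by norm_num) ((neg_dvd).2 (Dvd.intro _ hmn))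
    clear_value m n
    have h7 : -4 ≤ m := by linarith
    interval_cases m <;> omega
  have two : ∀ x : Dual ℤ (fixedCochar Θ), 2 • x = (2 : ℤ) • x := fun x ↦
    (ofNat_smul_eq_nsmul ℤ 2 x).symm
  rcases hm with hm | hm | hm | hm | hm | hm <;> rw [hm] at hca
  · refine absurd ha.1 ?_
    rw [one_smul] at hca
    rw [← hca, ← two]
    exact hc.2
  · refine absurd (hneg ha.1) ?_
    rw [neg_smul, one_smul] at hca
    rw [← hca, ← two]
    exact hc.2
  · exact Or.inl (h2c _ _ hca).symm
  · refine Or.inr (h2c _ _ ?_)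
    rw [smul_neg, hca]; module
  · refine absurd hc.1 ?_
    rw [h2c c (2 • a) (by rw [hca]; module)]
    exact ha.2
  · refine absurd (hneg hc.1) ?_
    rw [h2c (-c) (2 • a) (by rw [smul_neg, hca]; module)]
    exact ha.2

end FixedPoints

/-! ### Products of orthogonal reflections; translations and linear parts -/

section Orthogonal

variable {ι X Y : Type*} [AddCommGroup X] [AddCommGroup Y] {P : RootDatum ι X Y}

/-- The product of the affine reflections in pairwise orthogonal roots. -/
theorem exists_prod_affineReflection (s : Finset ι)
    (hs : ∀ i ∈ s, ∀ j ∈ s, i ≠ j → P.pairing i j = 0) (k : ℤ) :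
    ∃ w ∈ affineWeyl P,
      (∀ x : Apartment Y,
        w • x = x - ∑ i ∈ s, (rootForm P i x - k) • ((1 : ℝ) ⊗ₜ[ℤ] P.coroot i)) ∧
      ∀ (p : Apartment Y) (u : ExtAffineWeyl P), (∀ i ∈ s, SameSide P i k p (u • p)) →
        BruhatRel P p u (w * u) := by
  classical
  induction s using Finset.induction_on with
  | empty => exact ⟨1, one_mem _, fun x ↦ by simp, fun p u _ ↦ by rw [one_mul]⟩
  | insert j s hj ih =>
    obtain ⟨w, hw, h1, h2⟩ := ih fun i hi l hl ↦
      hs i (Finset.mem_insert_of_mem hi) l (Finset.mem_insert_of_mem hl)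
    -- By orthogonality the earlier reflections do not change α_j. The formula for the product and
    -- the side condition for the next step are thus inherited from the starting point.
    have h3 : ∀ x : Apartment Y, rootForm P j (w • x) = rootForm P j x := fun x ↦ by
      rw [h1, map_sub, map_sum, sub_eq_self]
      refine Finset.sum_eq_zero fun i hi ↦ ?_
      rw [map_smul, rootForm_coroot, hs j (Finset.mem_insert_self _ _) i
        (Finset.mem_insert_of_mem hi) (fun h ↦ hj (h ▸ hi)), Int.cast_zero, smul_zero]
    refine ⟨affineReflection P j k * w, mul_mem (affineReflection_mem P j k) hw, fun x ↦ ?_,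
      fun p u hu ↦ ?_⟩
    · rw [mul_smul, affineReflection_smul, h3, h1, Finset.sum_insert hj]
      abel
    · refine (h2 p u fun i hi ↦ hu i (Finset.mem_insert_of_mem hi)).tail
        ⟨j, k, mul_assoc _ _ _, ?_⟩
      have := hu j (Finset.mem_insert_self _ _)
      rwa [SameSide, mul_smul, h3]

theorem mk_zero_mem_affineWeyl (w : P.weylGroup) : ExtAffineWeyl.mk P 0 w ∈ affineWeyl P := by
  obtain ⟨w, hw⟩ := w
  induction hw using RootPairing.weylGroup.induction with
  | mem i =>
    have : ExtAffineWeyl.mk P 0 (RootPairing.weylGroup.ofIdx P i) = affineReflection P i 0 := by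
      rw [affineReflection, zero_smul]
    exact this ▸ affineReflection_mem P i 0
  | one => exact one_mem (affineWeyl P)
  | mul x y hx hy h1 h2 =>
    have : ExtAffineWeyl.mk P 0 (⟨x, hx⟩ * ⟨y, hy⟩)
        = ExtAffineWeyl.mk P 0 ⟨x, hx⟩ * ExtAffineWeyl.mk P 0 ⟨y, hy⟩ :=
      map_mul (SemidirectProduct.inr : P.weylGroup →* Multiplicative Y ⋊[weylMulAut P] P.weylGroup)
        _ _
    exact this ▸ mul_mem h1 h2

theorem eq_mk_mul_mk (u : ExtAffineWeyl P) :
    u = ExtAffineWeyl.mk P u.trans 1 * ExtAffineWeyl.mk P 0 u.lin :=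
  (SemidirectProduct.inl_left_mul_inr_right
    (x := (u : Multiplicative Y ⋊[weylMulAut P] P.weylGroup))).symm

theorem mk_one_smul (y : Y) (x : Apartment Y) :
    ExtAffineWeyl.mk P y 1 • x = x + (1 : ℝ) ⊗ₜ[ℤ] y := by
  rw [smul_eq]
  change (weylAct P 1).toLinearMap.baseChange ℝ x + (1 : ℝ) ⊗ₜ[ℤ] y = _
  rw [map_one]
  congr 1
  exact LinearMap.congr_fun (LinearMap.baseChange_id (R := ℤ) (A := ℝ) (M := Y)) x

end Orthogonal

/-! ### Lifting the extended affine Weyl group of R^[Θ] to that of R -/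

section Lifts

theorem fixedIncl_injective {ι X Y : Type*} [AddCommGroup X] [AddCommGroup Y] {P : RootDatum ι X Y}
    {b : P.Base} {Θ : BasedAut P b} : Function.Injective (fixedIncl Θ) :=
  Module.Flat.lTensor_preserves_injective_linearMap (M := ℝ) (fixedCochar Θ).subtype
    (fixedCochar Θ).subtype_injective

variable {ι X Y : Type*} [Finite ι] [AddCommGroup X] [AddCommGroup Y] [Module.Finite ℤ Y]
  {P : RootDatum ι X Y} {b : P.Base} (Θ : BasedAut P b)

/-- The affine transformation `w` of `X_* ⊗ ℝ` restricts to `u`. -/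
def Lifts (u : ExtAffineWeyl (steinberg Θ)) (w : ExtAffineWeyl P) : Prop :=
  ∀ p : Apartment (fixedCochar Θ), fixedIncl Θ (u • p) = w • fixedIncl Θ p

variable {Θ}

theorem Lifts.mul {u v : ExtAffineWeyl (steinberg Θ)} {w z : ExtAffineWeyl P} (h : Lifts Θ u w)
    (h' : Lifts Θ v z) : Lifts Θ (u * v) (w * z) := fun p ↦ by
  rw [mul_smul, mul_smul, h, h']

theorem Lifts.inv {u : ExtAffineWeyl (steinberg Θ)} {w : ExtAffineWeyl P} (h : Lifts Θ u w) :
    Lifts Θ u⁻¹ w⁻¹ := fun p ↦ by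
  rw [eq_inv_smul_iff, ← h, smul_inv_smul]

theorem Lifts.one : Lifts Θ 1 1 := fun p ↦ by rw [one_smul, one_smul]

/-- The lift is the product of the reflections in the roots restricting to `a`. They are pairwise
orthogonal, and their coroots add up to the coroot of `a`. Their hyperplanes have one common trace,
so a single side condition in A^[Θ] makes every factor a Bruhat step. -/
theorem exists_lift_affineReflection (a : fixedRoots Θ) (k : ℤ) :
    ∃ w ∈ affineWeyl P, Lifts Θ (affineReflection (steinberg Θ) a k) w ∧
      ∀ (p : Apartment (fixedCochar Θ)) (u : ExtAffineWeyl (steinberg Θ)) (v : ExtAffineWeyl P),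
        Lifts Θ u v → SameSide (steinberg Θ) a k p (u • p) →
        BruhatRel P (fixedIncl Θ p) v (w * v) := by
  classical
  have := Fintype.ofFinite ι
  have hres : ∀ i ∈ ({i | resRoot Θ i = a} : Finset ι), resRoot Θ i = a := fun i hi ↦
    (Finset.mem_filter.1 hi).2
  obtain ⟨w, hw, h1, h2⟩ := exists_prod_affineReflection (P := P) {i | resRoot Θ i = a} (by
    intro i hi j hj hij
    exact pairing_eq_zero_of_resRoot_eq Θ hij ((hres i hi).trans (hres j hj).symm)
      (hres j hj ▸ a.2)) k
  refine ⟨w, hw, fun p ↦ ?_, fun p u v huv hs ↦ h2 _ _ fun i hi ↦ ?_⟩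
  · rw [affineReflection_smul, steinberg_coroot, map_sub, map_smul, fixedIncl_tmul, h1]
    change _ - _ • ((1 : ℝ) ⊗ₜ[ℤ] sumCoroot Θ a) = _
    rw [sumCoroot_eq, tmul_sum, Finset.smul_sum]
    congr 1
    refine Finset.sum_congr rfl fun i hi ↦ ?_
    rw [rootForm_steinberg Θ (n := 1) (i := i) (by rw [hres i hi, one_smul]), Int.cast_one, one_mul]
  · rw [← huv, ← sameSide_steinberg Θ one_pos (by rw [hres i hi, one_smul]), one_mul]
    exact hs

/-- A translation lifts to the same translation, and the linear part is a product of reflections,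
each of which lifts. -/
theorem Lifts.exists (u : ExtAffineWeyl (steinberg Θ)) : ∃ w, Lifts Θ u w := by
  rw [eq_mk_mul_mk u]
  have h1 : ∀ y, Lifts Θ (ExtAffineWeyl.mk (steinberg Θ) y 1) (ExtAffineWeyl.mk P y 1) :=
    fun y p ↦ by rw [mk_one_smul, mk_one_smul, map_add, fixedIncl_tmul]
  have h2 : ∀ v : affineWeyl (steinberg Θ), ∃ w, Lifts Θ v w := by
    rintro ⟨v, hv⟩
    induction hv using Subgroup.closure_induction with
    | mem x hx =>
      obtain ⟨a, k, rfl⟩ := hx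
      obtain ⟨w, -, hw, -⟩ := exists_lift_affineReflection a k
      exact ⟨w, hw⟩
    | one => exact ⟨1, Lifts.one⟩
    | mul x y _ _ hx hy =>
      obtain ⟨w, hw⟩ := hx
      obtain ⟨z, hz⟩ := hy
      exact ⟨w * z, hw.mul hz⟩
    | inv x _ hx =>
      obtain ⟨w, hw⟩ := hx
      exact ⟨w⁻¹, hw.inv⟩
  obtain ⟨w, hw⟩ := h2 ⟨_, mk_zero_mem_affineWeyl u.lin⟩
  exact ⟨_, (h1 _).mul hw⟩

variable [P.IsReduced] {p : Apartment (fixedCochar Θ)}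

/-- Two lifts differ by an element fixing A^[Θ] pointwise. It fixes 0, so it lies in the finite Weyl
group, hence in W_aff, and since it also fixes a generic point it is trivial. This uniqueness also
makes the choice of lifts multiplicative. -/
theorem Lifts.eq (hp : IsGeneric P (fixedIncl Θ p)) {u : ExtAffineWeyl (steinberg Θ)}
    {w z : ExtAffineWeyl P} (hw : Lifts Θ u w) (hz : Lifts Θ u z) : w = z := by
  have h : ∀ q, (w⁻¹ * z) • fixedIncl Θ q = fixedIncl Θ q := fun q ↦ by
    rw [mul_smul, ← hz, hw, inv_smul_smul]
  have h0 : (w⁻¹ * z).trans = 0 := by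
    have := h 0
    rw [map_zero, smul_eq, map_zero, zero_add] at this
    exact tmul_one_injective P (this.trans (tmul_zero _ _).symm)
  have hmem : w⁻¹ * z ∈ affineWeyl P := by
    have := mk_zero_mem_affineWeyl (P := P) (w⁻¹ * z).lin
    rwa [← h0] at this
  have := eq_one_of_smul_mem_facetOf hp hmem (by rw [h]; exact mem_facetOf_self _)
  exact inv_mul_eq_one.1 this

theorem existsUnique_naturalInclusion (hp : IsGeneric P (fixedIncl Θ p)) :
    ∃! j : ExtAffineWeyl (steinberg Θ) →* ExtAffineWeyl P, IsNaturalInclusion Θ j := by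
  choose f hf using Lifts.exists (Θ := Θ)
  refine ⟨⟨⟨f, (hf 1).eq hp Lifts.one⟩, fun u v ↦ (hf (u * v)).eq hp ((hf u).mul (hf v))⟩, hf,
    fun j hj ↦ MonoidHom.ext fun u ↦ Lifts.eq hp (hj u) (hf u)⟩

end Lifts

/-! ### The inclusion j: minimality, preservation and reflection of the Bruhat order -/

section NaturalInclusion

variable {ι X Y : Type*} [Finite ι] [AddCommGroup X] [AddCommGroup Y] [Module.Finite ℤ Y]
  {P : RootDatum ι X Y} {b : P.Base} {Θ : BasedAut P b}
  {j : ExtAffineWeyl (steinberg Θ) →* ExtAffineWeyl P} {p x x₁ x₂ : Apartment (fixedCochar Θ)}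

theorem IsNaturalInclusion.injective (hj : IsNaturalInclusion Θ j) : Function.Injective j := by
  intro u v huv
  refine smul_injective _ fun x ↦ fixedIncl_injective ?_
  rw [hj, hj, huv]

/-- Any hyperplane of R through `x` cuts A^[Θ] in a hyperplane of R^[Θ] through `x`, so no new
separation conditions appear in the larger apartment. -/
theorem IsNaturalInclusion.isMinimalAt (hj : IsNaturalInclusion Θ j)
    {u : ExtAffineWeyl (steinberg Θ)} (hu : IsMinimalAt (steinberg Θ) p x u) :
    IsMinimalAt P (fixedIncl Θ p) (fixedIncl Θ x) (j u) := by
  intro i k hik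
  obtain ⟨a, n, hn, ha⟩ := exists_fixedRoot Θ i
  rw [← hj, ← sameSide_steinberg Θ hn ha]
  exact hu a _ ((rootForm_steinberg_eq_iff Θ hn ha k x).2 hik)

theorem IsNaturalInclusion.isBiminimal (hj : IsNaturalInclusion Θ j)
    {u : ExtAffineWeyl (steinberg Θ)} (hu : IsBiminimal (steinberg Θ) p x₁ x₂ u) :
    IsBiminimal P (fixedIncl Θ p) (fixedIncl Θ x₁) (fixedIncl Θ x₂) (j u) :=
  ⟨hj.isMinimalAt hu.left, by rw [← map_inv]; exact hj.isMinimalAt hu.right⟩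

variable [P.IsReduced]

theorem IsNaturalInclusion.map_mem_affineWeyl (hj : IsNaturalInclusion Θ j)
    (hp : IsGeneric P (fixedIncl Θ p)) {u : ExtAffineWeyl (steinberg Θ)}
    (hu : u ∈ affineWeyl (steinberg Θ)) : j u ∈ affineWeyl P := by
  suffices H : affineWeyl (steinberg Θ) ≤ (affineWeyl P).comap j from H hu
  rw [affineWeyl, Subgroup.closure_le]
  rintro _ ⟨a, k, rfl⟩
  obtain ⟨w, hw, h, -⟩ := exists_lift_affineReflection a k
  have : j (affineReflection (steinberg Θ) a k) = w := Lifts.eq hp (hj _) h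
  change j (affineReflection (steinberg Θ) a k) ∈ affineWeyl P
  rwa [this]

theorem IsNaturalInclusion.map_mem_facetStab (hj : IsNaturalInclusion Θ j)
    (hp : IsGeneric P (fixedIncl Θ p)) {u : ExtAffineWeyl (steinberg Θ)}
    (hu : u ∈ facetStab (steinberg Θ) (facetOf (steinberg Θ) x)) :
    j u ∈ facetStab P (facetOf P (fixedIncl Θ x)) := by
  rw [mem_facetStab_iff] at hu ⊢
  refine ⟨hj.map_mem_affineWeyl hp hu.1, ?_⟩
  rw [← hj, fixedIncl_mem_facetOf_iff]
  exact hu.2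

/-- The inclusion of extended affine Weyl groups preserves the Bruhat order. -/
theorem IsNaturalInclusion.bruhatRel_map (hj : IsNaturalInclusion Θ j)
    (hp : IsGeneric P (fixedIncl Θ p)) {u v : ExtAffineWeyl (steinberg Θ)}
    (h : BruhatRel (steinberg Θ) p u v) : BruhatRel P (fixedIncl Θ p) (j u) (j v) := by
  induction h with
  | refl => exact .refl
  | tail _ h ih =>
    refine ih.trans ?_
    obtain ⟨a, k, rfl, hs⟩ := h
    obtain ⟨w, -, h, hw⟩ := exists_lift_affineReflection a k
    rw [map_mul, Lifts.eq hp (hj (affineReflection (steinberg Θ) a k)) h]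
    exact hw p _ _ (hj _) hs

/-- The inclusion of extended affine Weyl groups reflects the Bruhat order. -/
theorem IsNaturalInclusion.bruhatRel_of_map (hj : IsNaturalInclusion Θ j)
    (hp : IsGeneric P (fixedIncl Θ p)) {u v : ExtAffineWeyl (steinberg Θ)}
    (h : BruhatRel P (fixedIncl Θ p) (j u) (j v)) : BruhatRel (steinberg Θ) p u v := by
  have hp' : IsGeneric (steinberg Θ) p := (isGeneric_fixedIncl_iff Θ).1 hp
  have : Finite (fixedRoots Θ) := finite_fixedRoots Θ
  induction hn : length (steinberg Θ) (facetOf (steinberg Θ) p) v using Nat.strong_induction_on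
    generalizing u v with
  | _ n ih =>
    -- In this case j v preserves the alcove of p in A, so no Bruhat step of R ends at j v, and j u
    -- = j v.
    by_cases hv : v • p ∈ facetOf (steinberg Θ) p
    · generalize hjv : j v = w at h
      cases h with
      | refl => rw [hj.injective hjv]
      | tail _ h =>
        obtain ⟨i, k, rfl, hs⟩ := h
        rw [← fixedIncl_mem_facetOf_iff, hj, hjv] at hv
        have := (mem_facetOf.1 hv i k).symm
        rw [mul_smul, sameSide_affineReflection_iff (hp i k) (hp.smul _ i k)] at this
        exact absurd hs this
    obtain ⟨a, k, hw, hs⟩ := exists_wall_separating hp' (hp'.smul v) hv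
    obtain ⟨x, hx, hxp⟩ := isWall_facetOf_iff.1 hw
    set t := affineReflection (steinberg Θ) a k with ht
    have htv : SameSide (steinberg Θ) a k p ((t * v) • p) := by
      rw [mul_smul, sameSide_affineReflection_iff (hp' a k) (hp'.smul v a k)]
      exact hs
    have hstep : BruhatStep (steinberg Θ) p (t * v) v :=
      ⟨a, k, (affineReflection_mul_cancel_left _ _ _ _).symm, htv⟩
    -- In A many hyperplanes may pass through x, but all have the chosen wall as trace. One side
    -- condition therefore gives minimality in the whole coset W_x j z.
    have hmin : ∀ z : ExtAffineWeyl (steinberg Θ), SameSide (steinberg Θ) a k p (z • p) →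
        IsMinimalAt P (fixedIncl Θ p) (fixedIncl Θ x) (j z) := fun z hz ↦
      hj.isMinimalAt fun c l hc ↦ (sameSide_iff_of_hyperplane_subset (hx.2 c l hc).ge _ _).2 hz
    have hjt : j t ∈ facetStab P (facetOf P (fixedIncl Θ x)) :=
      hj.map_mem_facetStab hp (affineReflection_mem_facetStab hx.1)
    have hxp' := (adheres_fixedIncl_iff Θ).2 hxp
    -- Monotonicity of minimal elements gives j u ≤ j (t v) if u p is on the side of p, and j (t u)
    -- ≤ j (t v) otherwise. Since t v is shorter than v, induction applies in both cases; the second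
    -- one ends with the lifting property.
    by_cases hu : SameSide (steinberg Θ) a k p (u • p)
    · have h1 := h.minimal_mono hp hxp' (one_mem _) hjt (by rw [one_mul]; exact hmin u hu)
      rw [one_mul, ← map_mul] at h1
      exact (ih _ (hn ▸ hstep.length_lt hp') h1 rfl).tail hstep
    · have h1 := h.minimal_mono hp hxp' hjt hjt (by
        rw [← map_mul]
        refine hmin _ ?_
        rw [mul_smul, sameSide_affineReflection_iff (hp' a k) (hp'.smul u a k)]
        exact hu)
      rw [← map_mul, ← map_mul] at h1
      have h2 := (ih _ (hn ▸ hstep.length_lt hp') h1 rfl).affineReflection_mul hw htv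
      rwa [affineReflection_mul_cancel_left, affineReflection_mul_cancel_left] at h2

end NaturalInclusion

end SteinbergRootDatum

/-! ### The theorem -/

theorem theorem8p1p4 {ι X Y : Type*} [Finite ι] [AddCommGroup X] [AddCommGroup Y]
    [Module.Finite ℤ X] [Module.Finite ℤ Y]
    (P : RootDatum ι X Y) [P.IsReduced] (b : P.Base) (Θ : BasedAut P b)
    (a f₁ f₂ : Set (Apartment Y))
    (ha : IsAlcove P a) (hf₁ : IsFacet P f₁) (hf₂ : IsFacet P f₂)
    (hf₁a : IsSubfacet f₁ a) (hf₂a : IsSubfacet f₂ a)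
    (ha_meets : (fixedPart Θ a).Nonempty)
    (hf₁_meets : (fixedPart Θ f₁).Nonempty) (hf₂_meets : (fixedPart Θ f₂).Nonempty) :
    -- `a^{[Θ]}` is an alcove, and the `f_i^{[Θ]}` are subfacets of it
    (IsAlcove (steinberg Θ) (fixedPart Θ a) ∧
      (IsFacet (steinberg Θ) (fixedPart Θ f₁) ∧ IsSubfacet (fixedPart Θ f₁) (fixedPart Θ a)) ∧
      (IsFacet (steinberg Θ) (fixedPart Θ f₂) ∧ IsSubfacet (fixedPart Θ f₂) (fixedPart Θ a))) ∧
    -- the extended affine Weyl group of `R^{[Θ]}` is naturally a subgroup of that of `R`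
    (∃! j : ExtAffineWeyl (steinberg Θ) →* ExtAffineWeyl P, IsNaturalInclusion Θ j) ∧
    ∀ j : ExtAffineWeyl (steinberg Θ) →* ExtAffineWeyl P, IsNaturalInclusion Θ j →
      Function.Injective j ∧
      -- the inclusion induces an injective map of double coset spaces, and the Bruhat order
      -- on the source is the restriction of the Bruhat order on the target
      ∃ φ : DoubleCosets (steinberg Θ) (fixedPart Θ f₁) (fixedPart Θ f₂) → DoubleCosets P f₁ f₂,
        (∀ u, φ (DoubleCoset.mk (facetStab (steinberg Θ) (fixedPart Θ f₁))
              (facetStab (steinberg Θ) (fixedPart Θ f₂)) u)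
            = DoubleCoset.mk (facetStab P f₁) (facetStab P f₂) (j u)) ∧
        Function.Injective φ ∧
        ∀ w x : DoubleCosets (steinberg Θ) (fixedPart Θ f₁) (fixedPart Θ f₂),
          DoubleCosetBruhatLE (fixedPart Θ a) w x ↔ DoubleCosetBruhatLE a (φ w) (φ x) := by
  obtain ⟨p, rfl⟩ := ha.1.exists_eq_facetOf_fixedIncl ha_meets
  obtain ⟨x₁, rfl⟩ := hf₁.exists_eq_facetOf_fixedIncl hf₁_meets
  obtain ⟨x₂, rfl⟩ := hf₂.exists_eq_facetOf_fixedIncl hf₂_meets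
  have hp : IsGeneric P (fixedIncl Θ p) := isAlcove_facetOf_iff.1 ha
  have hp' : IsGeneric (steinberg Θ) p := (isGeneric_fixedIncl_iff Θ).1 hp
  have h₁ := isSubfacet_iff.1 hf₁a
  have h₂ := isSubfacet_iff.1 hf₂a
  have h₁' := (adheres_fixedIncl_iff Θ).1 h₁
  have h₂' := (adheres_fixedIncl_iff Θ).1 h₂
  have : Finite (fixedRoots Θ) := finite_fixedRoots Θ
  -- The types of double cosets depend on these sets, so they are made variables and then replaced
  -- by facets of R^[Θ].
  generalize hg : fixedPart Θ (facetOf P (fixedIncl Θ p)) = g at *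
  generalize hg₁ : fixedPart Θ (facetOf P (fixedIncl Θ x₁)) = g₁ at *
  generalize hg₂ : fixedPart Θ (facetOf P (fixedIncl Θ x₂)) = g₂ at *
  obtain rfl := hg.symm.trans (fixedPart_facetOf Θ p)
  obtain rfl := hg₁.symm.trans (fixedPart_facetOf Θ x₁)
  obtain rfl := hg₂.symm.trans (fixedPart_facetOf Θ x₂)
  refine ⟨⟨isAlcove_facetOf_iff.2 hp', ⟨⟨x₁, rfl⟩, isSubfacet_iff.2 h₁'⟩,
    ⟨⟨x₂, rfl⟩, isSubfacet_iff.2 h₂'⟩⟩, existsUnique_naturalInclusion hp,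
    fun j hj ↦ ⟨hj.injective, ?_⟩⟩
  have hmk : ∀ u v, DoubleCoset.mk (facetStab (steinberg Θ) (facetOf (steinberg Θ) x₁))
        (facetStab (steinberg Θ) (facetOf (steinberg Θ) x₂)) u
      = DoubleCoset.mk (facetStab (steinberg Θ) (facetOf (steinberg Θ) x₁))
        (facetStab (steinberg Θ) (facetOf (steinberg Θ) x₂)) v →
      DoubleCoset.mk (facetStab P (facetOf P (fixedIncl Θ x₁)))
        (facetStab P (facetOf P (fixedIncl Θ x₂))) (j u)
      = DoubleCoset.mk (facetStab P (facetOf P (fixedIncl Θ x₁)))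
        (facetStab P (facetOf P (fixedIncl Θ x₂))) (j v) := fun u v h ↦ by
    obtain ⟨y₁, hy₁, y₂, hy₂, rfl⟩ := (DoubleCoset.eq _ _ _ _).1 h
    exact (DoubleCoset.eq _ _ _ _).2 ⟨j y₁, hj.map_mem_facetStab hp hy₁, j y₂,
      hj.map_mem_facetStab hp hy₂, by rw [map_mul, map_mul]⟩
  refine ⟨fun D ↦ DoubleCoset.mk _ _ (j (Quotient.out D)),
    fun u ↦ hmk _ _ (DoubleCoset.out_eq' _ _ _), fun D E hDE ↦ ?_, fun D E ↦ ?_⟩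
  -- With biminimal representatives u and v, the images j u and j v are biminimal in one double
  -- coset, hence equal.
  · obtain ⟨u, rfl, hu⟩ := exists_isBiminimal hp' h₁' h₂' D
    obtain ⟨v, rfl, hv⟩ := exists_isBiminimal hp' h₁' h₂' E
    have h := ((hmk _ _ (DoubleCoset.out_eq' _ _ _)).symm.trans hDE).trans
      (hmk _ _ (DoubleCoset.out_eq' _ _ _))
    rw [hj.injective ((hj.isBiminimal hu).eq hp h₁ h₂ (hj.isBiminimal hv) h)]
  · obtain ⟨u, rfl, hu⟩ := exists_isBiminimal hp' h₁' h₂' D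
    obtain ⟨v, rfl, hv⟩ := exists_isBiminimal hp' h₁' h₂' E
    beta_reduce
    rw [hmk _ u (DoubleCoset.out_eq' _ _ _), hmk _ v (DoubleCoset.out_eq' _ _ _),
      doubleCosetBruhatLE_iff hp' h₁' h₂' hu hv,
      doubleCosetBruhatLE_iff hp h₁ h₂ (hj.isBiminimal hu) (hj.isBiminimal hv)]
    exact ⟨hj.bruhatRel_map hp, hj.bruhatRel_of_map hp⟩
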